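/- Consider a randomized trial with generic full data vector $(W,A,L,Y,C^L,C^Y)\sim P$: baseline variables $W$, study arm $A\in\{0,1\}$, short-term outcome $L$, real primary outcome $Y$ with $E(Y^2)<\infty$, and indicators $C^L,C^Y\in\{0,1\}$ that $L$, respectively $Y$, has been observed. Assume (1) (randomization) $A$ is independent of $W$ and $P(A=1)=P(A=0)=1/2$; (2) (independent censoring) $(C^L,C^Y)$ is independent of $(W,A,L,Y)$; (3) (monotone censoring) $C^L\ge C^Y$ almost surely; and $p_y:=P(C^Y=1)>0$. The semiparametric model consists of all laws satisfying these assumptions. The data are i.i.d. copies, for $i=1,\dots,n$, of the observed vector $O=(W,A,C^L,C^LL,C^Y,C^YY)$. For $a\in\{0,1\}$ write $E_a,\mathrm{Var}_a$ for expectation and variance given $A=a$, so that $E_a(Y\mid X)=E(Y\mid X,A=a)$ is a function of $X$; $E,\mathrm{Var}$ without subscript refer to $P$. Let $$\gamma=\frac{\mathrm{Var}\{E_1(Y\mid W)-E_0(Y\mid W)\}}{\sum_a\mathrm{Var}_a(Y)},\qquad R^2_W=\frac{\sum_a\mathrm{Var}\{E_a(Y\mid W)\}}{\sum_a\mathrm{Var}_a(Y)},\qquad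 R^2_{L\mid W}=\frac{\sum_a\mathrm{Var}_a\{E_a(Y\mid L,W)-E_a(Y\mid W)\}}{\sum_a\mathrm{Var}_a(Y)}.$$ The estimand is $\Delta=\Delta(P)=E(Y\mid A=1)-E(Y\mid A=0)$. The unadjusted estimator is $\sum_iA_iC^Y_iY_i/\sum_iA_iC^Y_i-\sum_i(1-A_i)C^Y_iY_i/\sum_i(1-A_i)C^Y_i$. If $\sqrt n(\widehat\Delta-\Delta)$ converges in distribution to $N(0,\sigma^2)$, then $\mathrm{AVar}(\widehat\Delta):=\sigma^2$ is the asymptotic variance of $\widehat\Delta$; and $\mathrm{ARE}(\widehat\Delta_1,\widehat\Delta_2):=\mathrm{AVar}(\widehat\Delta_2)/\mathrm{AVar}(\widehat\Delta_1)\in[0,\infty]$. A regular parametric submodel through $P$ is a path $t\mapsto P_t$ with $P_0=P$, with $P_t$ in the model for $t$ near $0$, along which the law of $O$ has, with respect to its law under $P$, a density $1+t\,s(O)+o(t)$, uniformly, with bounded score $s$. The semiparametric lower bound at $P$ is the supremum, over these submodels, of the Cramér–Rao bounds $\{\tfrac{d}{dt}\Delta(P_t)|_{t=0}\}^2/E\{s(O)^2\}$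 (with $0/0=0$). An estimator is RAL (regular and asymptotically linear) at $P$ if $\sqrt n(\widehat\Delta-\Delta)=n^{-1/2}\sum_i\psi(O_i)+o_P(1)$ for some $\psi$ with $E\psi(O)=0$ and $E\psi(O)^2<\infty$, and if for every such submodel and every $h\in\mathbb R$ the limit law of $\sqrt n\{\widehat\Delta-\Delta(P_{h/\sqrt n})\}$ under i.i.d. sampling from $P_{h/\sqrt n}$ is the limit law $N(0,\mathrm{AVar}(\widehat\Delta))$ that it has under $P$. A RAL estimator is efficient at $P$ if its asymptotic variance equals the semiparametric lower bound. Suppose $R^2_{L\mid W}=0$. (i) ($W$ purely predictive.) If $\mathrm{Var}\{E_1(Y\mid W)-E_0(Y\mid W)\}>0$ and $\mathrm{Var}\{E(Y\mid W)\}=0$, then $\gamma=2R^2_W$, and for every efficient RAL estimator of $\Delta$ $$\mathrm{ARE}(\text{efficient},\text{unadjusted})=\frac1{1-(1-p_y)R^2_W}.$$ (ii) ($W$ purely prognostic.) If $\mathrm{Var}\{E_1(Y\mid W)-E_0(Y\mid W)\}=0$ and $\mathrm{Var}\{E(Y\mid W)\}>0$, then $\gamma=0$, and for every efficient RAL estimator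 of $\Delta$ $$\mathrm{ARE}(\text{efficient},\text{unadjusted})=\frac1{1-R^2_W},$$ which does not depend on $p_y$ (and is $\infty$ if $R^2_W=1$). -/

import Mathlib

open MeasureTheory ProbabilityTheory Filter Topology
open scoped ENNReal NNReal BoundedContinuousFunction

noncomputable section

namespace Trial

/-- Generic full data vector `(W, A, L, Y, C^L, C^Y)`: baseline variables `W`, study arm `A`
(`true` is treatment, `false` is control), short-term outcome `L`, primary outcome `Y`, and the
indicators that `L` and `Y` have been observed. The short-term outcome may be of any type; the
binary case is `𝓛 = Bool`. -/
abbrev FullData (𝒲 𝓛 : Type*) := 𝒲 × Bool × 𝓛 × ℝ × Bool × Bool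

section Projections

variable {𝒲 𝓛 : Type*}

def W (z : FullData 𝒲 𝓛) : 𝒲 := z.1
def A (z : FullData 𝒲 𝓛) : Bool := z.2.1
def L (z : FullData 𝒲 𝓛) : 𝓛 := z.2.2.1
def Y (z : FullData 𝒲 𝓛) : ℝ := z.2.2.2.1
def CL (z : FullData 𝒲 𝓛) : Bool := z.2.2.2.2.1
def CY (z : FullData 𝒲 𝓛) : Bool := z.2.2.2.2.2

end Projections

/-- What is observed on one participant: `W`, `A`, the value of `L` if `C^L = 1` and the value of
`Y` if `C^Y = 1` (the left summand `Unit` encodes a missing value). -/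
abbrev Obs (𝒲 𝓛 : Type*) := 𝒲 × Bool × (Unit ⊕ 𝓛) × (Unit ⊕ ℝ)

/-- The coarsening from full data to observed data. -/
def observe {𝒲 𝓛 : Type*} (z : FullData 𝒲 𝓛) : Obs 𝒲 𝓛 :=
  (W z, A z, if CL z = true then Sum.inr (L z) else Sum.inl (),
    if CY z = true then Sum.inr (Y z) else Sum.inl ())

section Law

variable {𝒲 𝓛 : Type*} [MeasurableSpace 𝒲] [MeasurableSpace 𝓛]

/-- The semiparametric model: all laws of the full data vector with square-integrable outcome and a
positive probability of observing `Y`, restricted only by randomization with probability `1/2`,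
independent censoring, and monotone censoring. -/
structure InModel (P : Measure (FullData 𝒲 𝓛)) : Prop where
  prob : IsProbabilityMeasure P
  memLp : MemLp Y 2 P
  randomization : IndepFun A W P
  half : P {z | A z = true} = 1 / 2
  independent_censoring :
    IndepFun (fun z => (CL z, CY z)) (fun z => (W z, A z, L z, Y z)) P
  monotone_censoring : ∀ᵐ z ∂P, CY z = true → CL z = true
  py_pos : 0 < P {z | CY z = true}

/-- `p_y`, the proportion of enrolled participants with `Y` observed. -/
def py (P : Measure (FullData 𝒲 𝓛)) : ℝ := P.real {z | CY z = true}

/-- The conditional law of the full data given `A = a`. -/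
def armLaw (P : Measure (FullData 𝒲 𝓛)) (a : Bool) : Measure (FullData 𝒲 𝓛) :=
  ProbabilityTheory.cond P {z | A z = a}

/-- The average treatment effect `Δ = E(Y | A = 1) - E(Y | A = 0)`. -/
def ate (P : Measure (FullData 𝒲 𝓛)) : ℝ :=
  (∫ z, Y z ∂(armLaw P true)) - ∫ z, Y z ∂(armLaw P false)

/-- The σ-algebra generated by `W`. -/
abbrev sigmaW : MeasurableSpace (FullData 𝒲 𝓛) :=
  MeasurableSpace.comap W inferInstance

/-- The σ-algebra generated by `(L, W)`. -/
abbrev sigmaLW : MeasurableSpace (FullData 𝒲 𝓛) :=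
  MeasurableSpace.comap (fun z => (L z, W z)) inferInstance

/-- `E(Y | W)`. -/
def condY (P : Measure (FullData 𝒲 𝓛)) : FullData 𝒲 𝓛 → ℝ :=
  condExp sigmaW P Y

/-- `E_a(Y | W) = E(Y | W, A = a)`, as a function of `W`: the conditional expectation
given `W` under the conditional law given `A = a`. -/
def armCondY (P : Measure (FullData 𝒲 𝓛)) (a : Bool) : FullData 𝒲 𝓛 → ℝ :=
  condExp sigmaW (armLaw P a) Y

/-- `E_a(Y | L, W) = E(Y | L, W, A = a)`, as a function of `(L, W)`. -/
def armCondYL (P : Measure (FullData 𝒲 𝓛)) (a : Bool) : FullData 𝒲 𝓛 → ℝ :=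
  condExp sigmaLW (armLaw P a) Y

/-- `Var{E_1(Y | W) - E_0(Y | W)}`. -/
def varEffect (P : Measure (FullData 𝒲 𝓛)) : ℝ :=
  variance (fun z => armCondY P true z - armCondY P false z) P

/-- `∑_a Var_a(Y)`. -/
def sumVar (P : Measure (FullData 𝒲 𝓛)) : ℝ :=
  ∑ a : Bool, variance Y (armLaw P a)

/-- The treatment effect heterogeneity `γ`. -/
def gammaHet (P : Measure (FullData 𝒲 𝓛)) : ℝ :=
  varEffect P / sumVar P

/-- `R²_W`, the proportion of variance in `Y` explained by `W`. -/
def rsqW (P : Measure (FullData 𝒲 𝓛)) : ℝ :=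
  (∑ a : Bool, variance (armCondY P a) P) / sumVar P

/-- `R²_{L|W}`, the proportion of additional variance in `Y` explained by `L` after `W`. -/
def rsqLW (P : Measure (FullData 𝒲 𝓛)) : ℝ :=
  (∑ a : Bool, variance (fun z => armCondYL P a z - armCondY P a z) (armLaw P a)) / sumVar P

/-- The law of the observed data on one participant. -/
def obsLaw (P : Measure (FullData 𝒲 𝓛)) : Measure (Obs 𝒲 𝓛) :=
  P.map observe

/-- The law of an i.i.d. sample of observed data on `n` participants. -/
def sampleLaw (P : Measure (FullData 𝒲 𝓛)) (n : ℕ) : Measure (Fin n → Obs 𝒲 𝓛) :=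
  Measure.pi fun _ => obsLaw P

/-- A regular one-dimensional parametric submodel `t ↦ Pt t` through `P`, with score `s` (at
`t = 0`) for one observation. For `t` near `0` the law `Pt t` is in the model, and the observed data
law has a density with respect to that at `t = 0`, which is differentiable at `t = 0` uniformly
(in `L^∞`) with bounded derivative `s`. (Bounded scores are the usual choice when the outcome
may be unbounded: the mean of an unbounded outcome is not differentiable along
arbitrary quadratic mean differentiable submodels.) -/
structure IsSubmodel (P : Measure (FullData 𝒲 𝓛)) (Pt : ℝ → Measure (FullData 𝒲 𝓛))
    (s : Obs 𝒲 𝓛 → ℝ) : Prop where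
  at_zero : Pt 0 = P
  in_model : ∀ᶠ t in 𝓝 (0 : ℝ), InModel (Pt t)
  score_measurable : Measurable s
  score_bounded : ∃ C : ℝ, ∀ᵐ o ∂(obsLaw P), |s o| ≤ C
  density : ∃ g : ℝ → Obs 𝒲 𝓛 → ℝ, (∀ t, Measurable (g t)) ∧
    (∀ᶠ t in 𝓝 (0 : ℝ),
      obsLaw (Pt t) = (obsLaw P).withDensity fun o => ENNReal.ofReal (g t o)) ∧
    ∀ ε > 0, ∀ᶠ t in 𝓝 (0 : ℝ), ∀ᵐ o ∂(obsLaw P), |g t o - 1 - t * s o| ≤ ε * |t|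

/-- The semiparametric lower bound on the asymptotic variance of regular estimators of `Δ` at `P`:
the supremum, over the regular parametric submodels through `P`, of the Cramér-Rao bound
`(dΔ/dt)² / (Fisher information)`, with `0/0 = 0`. -/
def efficiencyBound (P : Measure (FullData 𝒲 𝓛)) : ℝ≥0∞ :=
  sSup {b : ℝ≥0∞ | ∃ (Pt : ℝ → Measure (FullData 𝒲 𝓛)) (s : Obs 𝒲 𝓛 → ℝ) (d : ℝ),
    IsSubmodel P Pt s ∧ HasDerivAt (fun t => ate (Pt t)) d 0 ∧
    b = ENNReal.ofReal (d ^ 2) / ENNReal.ofReal (∫ o, s o ^ 2 ∂(obsLaw P))}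

end Law

/-- An estimator: for each sample size, a real function of the observed data. -/
abbrev Estimator (𝒲 𝓛 : Type*) := (n : ℕ) → (Fin n → Obs 𝒲 𝓛) → ℝ

/-- The sample mean of `Y` among the participants in arm `a` with `Y` observed. -/
def armMean {𝒲 𝓛 : Type*} (a : Bool) {n : ℕ} (o : Fin n → Obs 𝒲 𝓛) : ℝ :=
  (∑ i, if (o i).2.1 = a then Sum.elim (fun _ => (0 : ℝ)) (fun y => y) (o i).2.2.2 else 0) /
    ∑ i, if (o i).2.1 = a then Sum.elim (fun _ => (0 : ℝ)) (fun _ => 1) (o i).2.2.2 else 0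

/-- The unadjusted estimator, the difference between arms of the sample means of `Y` among
participants with `Y` observed:
`∑ A C^Y Y / ∑ A C^Y - ∑ (1 - A) C^Y Y / ∑ (1 - A) C^Y`. -/
def unadjusted {𝒲 𝓛 : Type*} : Estimator 𝒲 𝓛 :=
  fun _ o => armMean true o - armMean false o

section Asymptotics

variable {𝒲 𝓛 : Type*} [MeasurableSpace 𝒲] [MeasurableSpace 𝓛]

/-- `√n (T_n - Δ(Q_n))`, computed from `n` i.i.d. draws from `Q_n`, converges in distribution to
`N(0, v)`. -/
def CenteredLimit (Q : ℕ → Measure (FullData 𝒲 𝓛)) (T : Estimator 𝒲 𝓛) (v : ℝ≥0) : Prop :=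
  ∀ f : ℝ →ᵇ ℝ,
    Tendsto (fun n : ℕ => ∫ o, f (√(n : ℝ) * (T n o - ate (Q n))) ∂(sampleLaw (Q n) n)) atTop
      (𝓝 (∫ x, f x ∂(gaussianReal 0 v)))

/-- `v` is the asymptotic variance of the estimator `T` of `Δ` at `P`. -/
def IsAVar (P : Measure (FullData 𝒲 𝓛)) (T : Estimator 𝒲 𝓛) (v : ℝ≥0) : Prop :=
  (∀ n, Measurable (T n)) ∧ CenteredLimit (fun _ => P) T v

/-- `T` is asymptotically linear at `P`, with some influence function `ψ`. -/
def IsAsymptoticallyLinear (P : Measure (FullData 𝒲 𝓛)) (T : Estimator 𝒲 𝓛) : Prop :=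
  ∃ ψ : Obs 𝒲 𝓛 → ℝ, Measurable ψ ∧ MemLp ψ 2 (obsLaw P) ∧ ∫ o, ψ o ∂(obsLaw P) = 0 ∧
    ∀ ε > 0, Tendsto (fun n : ℕ => sampleLaw P n
      {o | ε ≤ |√(n : ℝ) * (T n o - ate P) - (√(n : ℝ))⁻¹ * ∑ i, ψ (o i)|}) atTop (𝓝 0)

/-- `T` is regular at `P`: along every regular parametric submodel, under the local parameter
values `t = h / √n`, the centered estimator has one and the same limit law `N(0, v)`. -/
def IsRegular (P : Measure (FullData 𝒲 𝓛)) (T : Estimator 𝒲 𝓛) (v : ℝ≥0) : Prop :=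
  ∀ (Pt : ℝ → Measure (FullData 𝒲 𝓛)) (s : Obs 𝒲 𝓛 → ℝ), IsSubmodel P Pt s →
    ∀ h : ℝ, CenteredLimit (fun n => Pt (h / √(n : ℝ))) T v

/-- `T` is a regular, asymptotically linear estimator of `Δ` at `P`, with asymptotic
variance `v`. -/
def IsRAL (P : Measure (FullData 𝒲 𝓛)) (T : Estimator 𝒲 𝓛) (v : ℝ≥0) : Prop :=
  IsAVar P T v ∧ IsAsymptoticallyLinear P T ∧ IsRegular P T v

/-- `T` is an efficient RAL estimator of `Δ` at `P`: its asymptotic variance is the semiparametric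
lower bound. -/
def IsEfficientRAL (P : Measure (FullData 𝒲 𝓛)) (T : Estimator 𝒲 𝓛) : Prop :=
  ∃ v : ℝ≥0, IsRAL P T v ∧ (v : ℝ≥0∞) = efficiencyBound P

/-- `r = ARE(T₁, T₂) = AVar(T₂) / AVar(T₁)` (in `[0, ∞]`, so it is `∞` if `AVar(T₁) = 0 < AVar(T₂)`):
both asymptotic variances exist, and `r` is their quotient. -/
def IsARE (P : Measure (FullData 𝒲 𝓛)) (T₁ T₂ : Estimator 𝒲 𝓛) (r : ℝ≥0∞) : Prop :=
  ∃ v₁ v₂ : ℝ≥0, IsAVar P T₁ v₁ ∧ IsAVar P T₂ v₂ ∧ r = (v₂ : ℝ≥0∞) / (v₁ : ℝ≥0∞)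

end Asymptotics

end Trial

end

noncomputable section

namespace Trial

/-! ### Coordinates, signs and indicators -/

section Measurability

variable {𝒲 𝓛 : Type*} [MeasurableSpace 𝒲] [MeasurableSpace 𝓛]

/-! Write S for the sum of the arm variances of Y, p for `py P`, and m_a(W) for E_a(Y | W).
Everything rests on comparing two second moments.

The unadjusted estimator is a difference of two ratios of i.i.d. sums, so the law of large numbers,
the central limit theorem and Slutsky give it the asymptotic variance 2S/p (`isAVar_unadjusted`).

For the lower bound, take φ = (2/p)(2A-1) C^Y (Y - m_A(W)) + m_1(W) - m_0(W) - Δ. Along every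
submodel with score s, the derivative of Δ is E(sφ) (`IsSubmodel.hasDerivAt_ate`): randomization and
independent censoring constrain the scores, which turns the derivative of an
inverse-probability-weighted formula for Δ into this form. Cauchy-Schwarz bounds the efficiency
bound by E(φ²), whatever L is. Conversely, when R²_{L|W} = 0, the residual has mean zero given (W,
A, L). Then φ is an L² limit of bounded scores, perturbing the law of W and the law of Y given (W,
A, L), and the bound equals E(φ²) (`efficiencyBound_eq`).

The two terms of φ are orthogonal, so E(φ²) = (2/p)(S - ∑ Var m_a) + Var(m_1 - m_0), which is
(2S/p)(1 - R²_W + pγ/2). The parallelogram identity Var(m_1 - m_0) + 4 Var E(Y | W) = 2 ∑ Var m_a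
(`InModel.varEffect_add`) gives γ = 2R²_W in case (i), while γ = 0 in case (ii); dividing 2S/p by
E(φ²) gives both formulas. -/

@[fun_prop] lemma measurable_W : Measurable (W : FullData 𝒲 𝓛 → 𝒲) := measurable_fst

@[fun_prop] lemma measurable_A : Measurable (A : FullData 𝒲 𝓛 → Bool) :=
  measurable_fst.comp measurable_snd

@[fun_prop] lemma measurable_L : Measurable (L : FullData 𝒲 𝓛 → 𝓛) :=
  measurable_fst.comp (measurable_snd.comp measurable_snd)

@[fun_prop] lemma measurable_Y : Measurable (Y : FullData 𝒲 𝓛 → ℝ) :=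
  measurable_fst.comp (measurable_snd.comp (measurable_snd.comp measurable_snd))

@[fun_prop] lemma measurable_CL : Measurable (CL : FullData 𝒲 𝓛 → Bool) :=
  measurable_fst.comp
    (measurable_snd.comp (measurable_snd.comp (measurable_snd.comp measurable_snd)))

@[fun_prop] lemma measurable_CY : Measurable (CY : FullData 𝒲 𝓛 → Bool) :=
  measurable_snd.comp
    (measurable_snd.comp (measurable_snd.comp (measurable_snd.comp measurable_snd)))

lemma measurableSet_arm (a : Bool) : MeasurableSet {z : FullData 𝒲 𝓛 | A z = a} :=
  measurable_A (measurableSet_singleton a)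

lemma measurableSet_CY (c : Bool) : MeasurableSet {z : FullData 𝒲 𝓛 | CY z = c} :=
  measurable_CY (measurableSet_singleton c)

lemma measurableSet_CL (c : Bool) : MeasurableSet {z : FullData 𝒲 𝓛 | CL z = c} :=
  measurable_CL (measurableSet_singleton c)

@[fun_prop] lemma measurable_observe :
    Measurable (observe : FullData 𝒲 𝓛 → Obs 𝒲 𝓛) := by
  refine measurable_W.prodMk (measurable_A.prodMk (Measurable.prodMk ?_ ?_))
  · exact Measurable.ite (measurableSet_CL true) (measurable_inr.comp measurable_L)
      measurable_const
  · exact Measurable.ite (measurableSet_CY true) (measurable_inr.comp measurable_Y)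
      measurable_const

/-- The sign `+1` of the treatment arm and `-1` of the control arm. -/
def sgn (a : Bool) : ℝ := if a = true then 1 else -1

/-- The real-valued indicator of a Boolean. -/
def ind (c : Bool) : ℝ := if c = true then 1 else 0

/-- The outcome, with `0` for a missing value. -/
def obsY (y : Unit ⊕ ℝ) : ℝ := Sum.elim (fun _ => (0 : ℝ)) (fun y => y) y

/-- The indicator that the outcome is observed. -/
def obsInd (y : Unit ⊕ ℝ) : ℝ := Sum.elim (fun _ => (0 : ℝ)) (fun _ => 1) y

@[fun_prop] lemma measurable_sgn : Measurable sgn := measurable_from_top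

@[fun_prop] lemma measurable_ind : Measurable ind := measurable_from_top

@[fun_prop] lemma measurable_obsY : Measurable obsY :=
  Measurable.sumElim measurable_const measurable_id

@[fun_prop] lemma measurable_obsInd : Measurable obsInd :=
  Measurable.sumElim measurable_const measurable_const

lemma obsY_observe {𝒲 𝓛 : Type*} (z : FullData 𝒲 𝓛) : obsY (observe z).2.2.2 = ind (CY z) * Y z := by
  by_cases h : CY z = true <;> simp [observe, obsY, ind, h]

lemma obsInd_observe {𝒲 𝓛 : Type*} (z : FullData 𝒲 𝓛) : obsInd (observe z).2.2.2 = ind (CY z) := by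
  by_cases h : CY z = true <;> simp [observe, obsInd, ind, h]

lemma ind_mul_self (c : Bool) : ind c * ind c = ind c := by
  cases c <;> simp [ind]

lemma sgn_mul_self (a : Bool) : sgn a * sgn a = 1 := by
  cases a <;> simp [sgn]

lemma abs_ind_le (c : Bool) : |ind c| ≤ 1 := by
  cases c <;> simp [ind]

lemma abs_sgn_le (a : Bool) : |sgn a| ≤ 1 := by
  cases a <;> simp [sgn]

/-- The part `(W, A, L, Y)` of the full data. -/
def core (z : FullData 𝒲 𝓛) : 𝒲 × Bool × 𝓛 × ℝ := (W z, A z, L z, Y z)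

@[fun_prop] lemma measurable_core : Measurable (core : FullData 𝒲 𝓛 → 𝒲 × Bool × 𝓛 × ℝ) := by
  unfold core; fun_prop

lemma measurable_arm_apply {m : Bool → 𝒲 → ℝ} (hm : ∀ a, Measurable (m a)) :
    Measurable fun x : Bool × 𝒲 => m x.1 x.2 :=
  measurable_from_prod_countable_right hm

end Measurability

/-! ### Consequences of randomization and independent censoring -/

section Arms

variable {𝒲 𝓛 : Type*} [MeasurableSpace 𝒲] [MeasurableSpace 𝓛] {P : Measure (FullData 𝒲 𝓛)}

lemma InModel.arm_half (hP : InModel P) (a : Bool) : P {z | A z = a} = 1 / 2 := by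
  have := hP.prob
  cases a
  · have h : {z : FullData 𝒲 𝓛 | A z = false} = {z | A z = true}ᶜ := by ext z; simp
    rw [h, prob_compl_eq_one_sub (measurableSet_arm true), hP.half]
    simp [ENNReal.one_sub_inv_two]
  · exact hP.half

lemma InModel.armLaw_eq (hP : InModel P) (a : Bool) :
    armLaw P a = (2 : ℝ≥0∞) • P.restrict {z | A z = a} := by
  simp [armLaw, ProbabilityTheory.cond, hP.arm_half]

lemma InModel.isProbabilityMeasure_armLaw (hP : InModel P) (a : Bool) :
    IsProbabilityMeasure (armLaw P a) := by
  have := hP.prob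
  exact cond_isProbabilityMeasure (by simp [hP.arm_half])

lemma InModel.integral_armLaw (hP : InModel P) (a : Bool) (f : FullData 𝒲 𝓛 → ℝ) :
    ∫ z, f z ∂(armLaw P a) = 2 * ∫ z in {z | A z = a}, f z ∂P := by
  rw [hP.armLaw_eq, integral_smul_measure]; simp

lemma InModel.memLp_armLaw (hP : InModel P) (a : Bool) {f : FullData 𝒲 𝓛 → ℝ} {p : ℝ≥0∞}
    (hf : MemLp f p P) : MemLp f p (armLaw P a) := by
  rw [hP.armLaw_eq]
  exact (hf.restrict _).smul_measure (by simp)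

lemma integral_eq_add_arms {f : FullData 𝒲 𝓛 → ℝ} (hf : Integrable f P) :
    ∫ z, f z ∂P = (∫ z in {z | A z = true}, f z ∂P) + ∫ z in {z | A z = false}, f z ∂P := by
  have h : {z : FullData 𝒲 𝓛 | A z = false} = {z | A z = true}ᶜ := by ext z; simp
  rw [h, integral_add_compl (measurableSet_arm true) hf]

/-- Randomization in the form used below: moments of functions of W may be computed under either arm
law or under P. -/
lemma InModel.map_W_armLaw (hP : InModel P) (a : Bool) :
    (armLaw P a).map W = P.map W := by
  ext s hs
  rw [Measure.map_apply measurable_W hs, Measure.map_apply measurable_W hs, hP.armLaw_eq,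
    Measure.smul_apply, Measure.restrict_apply (measurable_W hs), Set.inter_comm]
  have h := hP.randomization.measure_inter_preimage_eq_mul {a} s (measurableSet_singleton a) hs
  have h2 : A ⁻¹' {a} = {z : FullData 𝒲 𝓛 | A z = a} := rfl
  rw [h2, hP.arm_half] at h
  rw [h, smul_eq_mul, ← mul_assoc, one_div, ENNReal.mul_inv_cancel (by simp) (by simp), one_mul]

lemma InModel.integral_armLaw_W (hP : InModel P) (a : Bool) {f : 𝒲 → ℝ} (hf : Measurable f) :
    ∫ z, f (W z) ∂(armLaw P a) = ∫ z, f (W z) ∂P := by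
  rw [← integral_map (φ := W) measurable_W.aemeasurable hf.aestronglyMeasurable,
    ← integral_map (φ := W) measurable_W.aemeasurable hf.aestronglyMeasurable, hP.map_W_armLaw]

lemma InModel.setIntegral_arm_W (hP : InModel P) (a : Bool) {f : 𝒲 → ℝ} (hf : Measurable f) :
    ∫ z in {z | A z = a}, f (W z) ∂P = (∫ z, f (W z) ∂P) / 2 := by
  rw [← hP.integral_armLaw_W a hf, hP.integral_armLaw]; ring

lemma InModel.memLp_armLaw_W_iff (hP : InModel P) (a : Bool) {f : 𝒲 → ℝ} (hf : Measurable f)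
    {p : ℝ≥0∞} : MemLp (f ∘ W) p (armLaw P a) ↔ MemLp (f ∘ W) p P := by
  rw [← memLp_map_measure_iff hf.aestronglyMeasurable measurable_W.aemeasurable,
    ← memLp_map_measure_iff hf.aestronglyMeasurable measurable_W.aemeasurable, hP.map_W_armLaw]

lemma InModel.py_pos' (hP : InModel P) : 0 < py P := by
  have := hP.prob
  exact ENNReal.toReal_pos hP.py_pos.ne' (measure_ne_top _ _)

lemma integral_ind_CY : ∫ z, ind (CY z) ∂P = py P := by
  have : (fun z : FullData 𝒲 𝓛 => ind (CY z)) = Set.indicator {z | CY z = true} 1 := by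
    ext z; simp [ind, Set.indicator_apply]
  rw [this, integral_indicator_one (measurableSet_CY true)]; rfl

/-- No integrability is required: the product formula for independent real functions also holds for
the default values of the integral. -/
lemma InModel.integral_censor_mul_core (hP : InModel P) {h : Bool × Bool → ℝ}
    {k : 𝒲 × Bool × 𝓛 × ℝ → ℝ} (hk : Measurable k) :
    ∫ z, h (CL z, CY z) * k (core z) ∂P = (∫ z, h (CL z, CY z) ∂P) * ∫ z, k (core z) ∂P := by
  have := hP.prob
  exact hP.independent_censoring.integral_fun_comp_mul_comp (f := h) (g := k)
    (by fun_prop) (measurable_core.aemeasurable) (Measurable.of_discrete.aestronglyMeasurable)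
    hk.aestronglyMeasurable

lemma InModel.integral_CY_mul_core (hP : InModel P)
    {k : 𝒲 × Bool × 𝓛 × ℝ → ℝ} (hk : Measurable k) :
    ∫ z, ind (CY z) * k (core z) ∂P = py P * ∫ z, k (core z) ∂P := by
  rw [← integral_ind_CY]
  exact hP.integral_censor_mul_core (h := fun c => ind c.2) hk

lemma integral_sgn_mul {f : FullData 𝒲 𝓛 → ℝ} (hf : Integrable f P) :
    ∫ z, sgn (A z) * f z ∂P =
      (∫ z in {z | A z = true}, f z ∂P) - ∫ z in {z | A z = false}, f z ∂P := by
  have hint : Integrable (fun z => sgn (A z) * f z) P :=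
    hf.bdd_mul (c := 1) (by fun_prop) (ae_of_all _ fun z => abs_sgn_le _)
  rw [integral_eq_add_arms hint, sub_eq_add_neg, ← integral_neg]
  congr 1
  · exact setIntegral_congr_fun (measurableSet_arm true) fun z hz => by
      simp only [Set.mem_ofPred_eq] at hz; simp [sgn, hz]
  · exact setIntegral_congr_fun (measurableSet_arm false) fun z hz => by
      simp only [Set.mem_ofPred_eq] at hz; simp [sgn, hz]

lemma InModel.integral_sgn_W (hP : InModel P) {f : 𝒲 → ℝ} (hf : Measurable f)
    (hi : Integrable (fun z => f (W z)) P) : ∫ z, sgn (A z) * f (W z) ∂P = 0 := by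
  rw [integral_sgn_mul hi, hP.setIntegral_arm_W true hf, hP.setIntegral_arm_W false hf, sub_self]

end Arms

/-! ### The regression of Y on W within an arm -/

section Regression

variable {𝒲 𝓛 : Type*} [MeasurableSpace 𝒲] [MeasurableSpace 𝓛] {P : Measure (FullData 𝒲 𝓛)}
  {m : Bool → 𝒲 → ℝ}

/-- `m a` is a measurable version of the regression function `w ↦ E_a(Y | W = w)`. -/
structure IsRegression (P : Measure (FullData 𝒲 𝓛)) (m : Bool → 𝒲 → ℝ) : Prop where
  meas : ∀ a, Measurable (m a)
  eq : ∀ a, armCondY P a = m a ∘ W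

/-- The conditional expectation is strongly measurable for σ(W) everywhere, so Doob-Dynkin
factorization gives a pointwise equality. The regression of one arm can thus be evaluated on the
whole trial. -/
lemma exists_isRegression (P : Measure (FullData 𝒲 𝓛)) : ∃ m : Bool → 𝒲 → ℝ, IsRegression P m := by
  have h : ∀ a, ∃ f : 𝒲 → ℝ, StronglyMeasurable f ∧ armCondY P a = f ∘ W := fun a =>
    StronglyMeasurable.exists_eq_measurable_comp stronglyMeasurable_condExp
  choose f hf he using h
  exact ⟨f, fun a => (hf a).measurable, he⟩

/-- Conditional expectation contracts L² of the arm law, and the law of W is the same under P. -/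
lemma IsRegression.memLp (hm : IsRegression P m) (hP : InModel P) (a : Bool) :
    MemLp (fun z => m a (W z)) 2 P := by
  have := hP.isProbabilityMeasure_armLaw a
  refine (hP.memLp_armLaw_W_iff a (hm.meas a)).1 ?_
  rw [← hm.eq a]
  exact MemLp.condExp (by norm_num) (hP.memLp_armLaw a hP.memLp)

lemma IsRegression.measurable_apply (hm : IsRegression P m) :
    Measurable fun z : FullData 𝒲 𝓛 => m (A z) (W z) :=
  (measurable_arm_apply hm.meas).comp (measurable_A.prodMk measurable_W)

lemma IsRegression.memLp_apply (hm : IsRegression P m) (hP : InModel P) :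
    MemLp (fun z => m (A z) (W z)) 2 P := by
  refine MemLp.mono (((hm.memLp hP true).norm).add ((hm.memLp hP false).norm))
    hm.measurable_apply.aestronglyMeasurable (ae_of_all _ fun z => ?_)
  simp only [Pi.add_apply]
  rw [Real.norm_of_nonneg (add_nonneg (norm_nonneg _) (norm_nonneg _))]
  cases A z
  · linarith [norm_nonneg (m true (W z))]
  · linarith [norm_nonneg (m false (W z))]

/-- Pull f(W) out of the conditional expectation in the arm, then pass from the arm law of W to its
law under P; the 1/2 is P(A = a). -/
lemma IsRegression.setIntegral_mul (hm : IsRegression P m) (hP : InModel P) (a : Bool) {f : 𝒲 → ℝ}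
    (hf : Measurable f) (hfL : MemLp (fun z => f (W z)) 2 P) :
    ∫ z in {z | A z = a}, f (W z) * Y z ∂P = (∫ z, f (W z) * m a (W z) ∂P) / 2 := by
  have := hP.isProbabilityMeasure_armLaw a
  have hle : sigmaW ≤ (inferInstance : MeasurableSpace (FullData 𝒲 𝓛)) :=
    measurable_iff_comap_le.1 measurable_W
  have hYi := (hP.memLp_armLaw a hP.memLp)
  have h1 : (armLaw P a)[fun z => f (W z) * Y z | sigmaW] =ᵐ[armLaw P a]
      fun z => f (W z) * m a (W z) := by
    have := condExp_mul_of_stronglyMeasurable_left (m := sigmaW) (μ := armLaw P a)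
      (f := fun z => f (W z)) (g := Y)
      ((hf.comp (comap_measurable W)).stronglyMeasurable)
      ((hP.memLp_armLaw a hfL).integrable_mul hYi) (hYi.integrable (by norm_num))
    refine this.trans (Eventually.of_forall fun z => ?_)
    have h2 := congrFun (hm.eq a) z
    simp only [armCondY, Function.comp_apply] at h2
    simp [h2]
  have h2 := integral_condExp hle (μ := armLaw P a) (f := fun z => f (W z) * Y z)
  rw [integral_congr_ae h1, hP.integral_armLaw_W a (f := fun w => f w * m a w)
    (hf.mul (hm.meas a)), hP.integral_armLaw] at h2
  linarith

lemma IsRegression.integral_armLaw_Y (hm : IsRegression P m) (hP : InModel P) (a : Bool) :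
    ∫ z, Y z ∂(armLaw P a) = ∫ z, m a (W z) ∂P := by
  have := hP.prob
  have h := hm.setIntegral_mul hP a (f := fun _ => 1) measurable_const (memLp_const 1)
  simp only [one_mul] at h
  rw [hP.integral_armLaw, h]; ring

lemma IsRegression.ate_eq (hm : IsRegression P m) (hP : InModel P) :
    ate P = ∫ z, (m true (W z) - m false (W z)) ∂P := by
  have := hP.prob
  rw [ate, hm.integral_armLaw_Y hP, hm.integral_armLaw_Y hP, integral_sub
    ((hm.memLp hP true).integrable (by norm_num)) ((hm.memLp hP false).integrable (by norm_num))]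

lemma IsRegression.setIntegral_mul_resid (hm : IsRegression P m) (hP : InModel P) (a : Bool)
    {f : 𝒲 → ℝ} (hf : Measurable f) (hfL : MemLp (fun z => f (W z)) 2 P) :
    ∫ z in {z | A z = a}, f (W z) * (Y z - m a (W z)) ∂P = 0 := by
  simp_rw [mul_sub]
  rw [integral_sub, hm.setIntegral_mul hP a hf hfL,
    hP.setIntegral_arm_W a (f := fun w => f w * m a w) (hf.mul (hm.meas a)), sub_self]
  · exact (hfL.integrable_mul hP.memLp).integrableOn
  · exact (hfL.integrable_mul (hm.memLp hP a)).integrableOn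

/-- The law of total variance in one arm; the explained part may be taken under P because W is
randomized. -/
lemma IsRegression.setIntegral_resid_sq (hm : IsRegression P m) (hP : InModel P) (a : Bool) :
    ∫ z in {z | A z = a}, (Y z - m a (W z)) ^ 2 ∂P =
      (variance Y (armLaw P a) - variance (armCondY P a) P) / 2 := by
  have := hP.prob
  have := hP.isProbabilityMeasure_armLaw a
  have hYm : Integrable (fun z => m a (W z) * Y z) P := (hm.memLp hP a).integrable_mul hP.memLp
  have hmm : Integrable (fun z => m a (W z) * m a (W z)) P :=
    (hm.memLp hP a).integrable_mul (hm.memLp hP a)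
  have hYY : Integrable (fun z : FullData 𝒲 𝓛 => Y z * Y z) P := hP.memLp.integrable_mul hP.memLp
  have e : (fun z : FullData 𝒲 𝓛 => (Y z - m a (W z)) ^ 2) =
      fun z => Y z * Y z - 2 * (m a (W z) * Y z) + m a (W z) * m a (W z) := by
    ext z; ring
  have hs : Integrable (fun z : FullData 𝒲 𝓛 => Y z * Y z - 2 * (m a (W z) * Y z)) P :=
    hYY.sub (hYm.const_mul 2)
  rw [e, integral_add hs.integrableOn hmm.integrableOn,
    integral_sub hYY.integrableOn (hYm.const_mul 2).integrableOn, integral_const_mul,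
    hm.setIntegral_mul hP a (hm.meas a) (hm.memLp hP a),
    hP.setIntegral_arm_W a (f := fun w => m a w * m a w) ((hm.meas a).mul (hm.meas a)),
    variance_eq_sub (hP.memLp_armLaw a hP.memLp), hm.eq a,
    variance_eq_sub (X := m a ∘ W) (hm.memLp hP a), hP.integral_armLaw]
  have h2 := hm.integral_armLaw_Y hP a
  simp only [Pi.pow_apply, Function.comp_apply] at *
  rw [h2]
  simp only [pow_two]
  ring

end Regression

/-! ### Pathwise derivative of the treatment effect and the upper bound -/

/-- Differentiation of an expectation along a path of laws whose densities are
differentiable in `L^∞` with bounded derivative. -/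
lemma hasDerivAt_integral_of_density {Ω : Type*} [MeasurableSpace Ω] {ν : Measure Ω}
    {νt : ℝ → Measure Ω} {g : ℝ → Ω → ℝ} {s φ : Ω → ℝ} {C : ℝ} (h0 : νt 0 = ν)
    (hg : ∀ t, Measurable (g t)) (hs : Measurable s) (hC : ∀ᵐ o ∂ν, |s o| ≤ C)
    (hdens : ∀ᶠ t in 𝓝 (0 : ℝ), νt t = ν.withDensity fun o => ENNReal.ofReal (g t o))
    (happ : ∀ ε > 0, ∀ᶠ t in 𝓝 (0 : ℝ), ∀ᵐ o ∂ν, |g t o - 1 - t * s o| ≤ ε * |t|)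
    (hφ : Integrable φ ν) :
    HasDerivAt (fun t => ∫ o, φ o ∂(νt t)) (∫ o, s o * φ o ∂ν) 0 := by
  rw [hasDerivAt_iff_isLittleO, Asymptotics.isLittleO_iff]
  intro c hc
  set M := ∫ o, |φ o| ∂ν
  have hM : 0 ≤ M := integral_nonneg fun o => abs_nonneg _
  have hsφ : Integrable (fun o => s o * φ o) ν :=
    hφ.bdd_mul (c := C) hs.aestronglyMeasurable hC
  -- With this tolerance the remainder is at most c M / (M + 1) |t|; the added 1 covers M = 0.
  have hε : 0 < c / (M + 1) := by positivity
  -- Such t force 0 ≤ g ≤ 2, so that `ENNReal.ofReal` loses nothing and g φ is integrable.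
  have hsmall : ∀ᶠ t : ℝ in 𝓝 0, |t| * (|C| + c / (M + 1)) < 1 := by
    have : Tendsto (fun t : ℝ => |t| * (|C| + c / (M + 1))) (𝓝 0) (𝓝 0) := by
      have h : Continuous fun t : ℝ => |t| * (|C| + c / (M + 1)) := by fun_prop
      simpa using h.tendsto 0
    exact this.eventually (gt_mem_nhds one_pos)
  filter_upwards [hdens, happ _ hε, hsmall] with t hd ha ht
  have hb : ∀ᵐ o ∂ν, 0 ≤ g t o ∧ |g t o| ≤ 2 := by
    filter_upwards [ha, hC] with o h1 h2
    have h3 : |t * s o| ≤ |t| * |C| := by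
      rw [abs_mul]
      exact mul_le_mul_of_nonneg_left (h2.trans (le_abs_self C)) (abs_nonneg t)
    have h4 := abs_le.1 h1
    have h5 := abs_le.1 h3
    have h6 : |t| * |C| + c / (M + 1) * |t| < 1 := by linarith
    exact ⟨by linarith, abs_le.2 ⟨by linarith, by linarith⟩⟩
  have hgφ : Integrable (fun o => g t o * φ o) ν :=
    hφ.bdd_mul (c := 2) (hg t).aestronglyMeasurable (hb.mono fun o h => h.2)
  have e1 : ∫ o, φ o ∂(νt t) = ∫ o, g t o * φ o ∂ν := by
    rw [hd, integral_withDensity_eq_integral_toReal_smul (by fun_prop)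
      (ae_of_all _ fun o => ENNReal.ofReal_lt_top)]
    refine integral_congr_ae ?_
    filter_upwards [hb] with o ho
    simp [ENNReal.toReal_ofReal ho.1]
  have e2 : (∫ o, g t o * φ o ∂ν) - (∫ o, φ o ∂ν) - t * ∫ o, s o * φ o ∂ν =
      ∫ o, (g t o - 1 - t * s o) * φ o ∂ν := by
    have hsub : Integrable (fun o => g t o * φ o - φ o) ν := hgφ.sub hφ
    rw [← integral_const_mul, ← integral_sub hgφ hφ, ← integral_sub hsub (hsφ.const_mul t)]
    congr 1; ext o; ring
  simp only [sub_zero, h0, smul_eq_mul, e1, e2]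
  calc ‖∫ o, (g t o - 1 - t * s o) * φ o ∂ν‖
      ≤ ∫ o, c / (M + 1) * |t| * |φ o| ∂ν := by
        refine norm_integral_le_of_norm_le (hφ.abs.const_mul _) ?_
        filter_upwards [ha] with o ho
        rw [norm_mul, Real.norm_eq_abs, Real.norm_eq_abs]
        gcongr
    _ = c / (M + 1) * M * |t| := by rw [integral_const_mul]; ring
    _ ≤ c * ‖t‖ := by
        rw [Real.norm_eq_abs]
        gcongr
        rw [div_mul_eq_mul_div, div_le_iff₀ (by positivity)]
        nlinarith

section

variable {𝒲 𝓛 : Type*} [MeasurableSpace 𝒲] [MeasurableSpace 𝓛] {P : Measure (FullData 𝒲 𝓛)}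
  {m : Bool → 𝒲 → ℝ}

lemma integral_obsLaw {φ : Obs 𝒲 𝓛 → ℝ} (hφ : Measurable φ) :
    ∫ o, φ o ∂(obsLaw P) = ∫ z, φ (observe z) ∂P :=
  integral_map measurable_observe.aemeasurable hφ.aestronglyMeasurable

lemma integrable_obsLaw_iff {φ : Obs 𝒲 𝓛 → ℝ} (hφ : Measurable φ) :
    Integrable φ (obsLaw P) ↔ Integrable (fun z => φ (observe z)) P :=
  integrable_map_measure hφ.aestronglyMeasurable measurable_observe.aemeasurable

lemma memLp_obsLaw_iff {φ : Obs 𝒲 𝓛 → ℝ} (hφ : Measurable φ) {p : ℝ≥0∞} :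
    MemLp φ p (obsLaw P) ↔ MemLp (fun z => φ (observe z)) p P :=
  memLp_map_measure_iff hφ.aestronglyMeasurable measurable_observe.aemeasurable

lemma InModel.isProbabilityMeasure_obsLaw (hP : InModel P) : IsProbabilityMeasure (obsLaw P) := by
  have := hP.prob
  exact Measure.isProbabilityMeasure_map measurable_observe.aemeasurable

lemma InModel.integrable_Y (hP : InModel P) : Integrable Y P := by
  have := hP.prob
  exact hP.memLp.integrable (by norm_num)

/-- The influence function that adjusts for the baseline variables through the regression
functions `m`. -/
def influence (P : Measure (FullData 𝒲 𝓛)) (m : Bool → 𝒲 → ℝ) (o : Obs 𝒲 𝓛) : ℝ :=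
  2 * sgn o.2.1 / py P * (obsY o.2.2.2 - obsInd o.2.2.2 * m o.2.1 o.1) +
    (m true o.1 - m false o.1 - ate P)

lemma IsRegression.measurable_influence (hm : IsRegression P m) :
    Measurable (influence P m : Obs 𝒲 𝓛 → ℝ) := by
  have h1 : Measurable fun o : Obs 𝒲 𝓛 => m o.2.1 o.1 :=
    (measurable_arm_apply hm.meas).comp (by fun_prop : Measurable fun o : Obs 𝒲 𝓛 => (o.2.1, o.1))
  have h2 : Measurable fun o : Obs 𝒲 𝓛 => m true o.1 - m false o.1 - ate P :=
    (((hm.meas true).comp measurable_fst).sub ((hm.meas false).comp measurable_fst)).sub_const _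
  exact ((by fun_prop : Measurable fun o : Obs 𝒲 𝓛 => 2 * sgn o.2.1 / py P).mul
    ((by fun_prop : Measurable fun o : Obs 𝒲 𝓛 => obsY o.2.2.2).sub
      ((by fun_prop : Measurable fun o : Obs 𝒲 𝓛 => obsInd o.2.2.2).mul h1))).add h2

/-- The scaled residual `2 (2 A - 1) (Y - E_A(Y | W)) / p_y`. -/
def resid (p : ℝ) (m : Bool → 𝒲 → ℝ) (x : 𝒲 × Bool × 𝓛 × ℝ) : ℝ :=
  2 * sgn x.2.1 / p * (x.2.2.2 - m x.2.1 x.1)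

lemma measurable_resid (p : ℝ) (hm : ∀ a, Measurable (m a)) :
    Measurable (resid p m : 𝒲 × Bool × 𝓛 × ℝ → ℝ) := by
  have h1 : Measurable fun o : 𝒲 × Bool × 𝓛 × ℝ => m o.2.1 o.1 :=
    (measurable_arm_apply hm).comp
      (by fun_prop : Measurable fun o : 𝒲 × Bool × 𝓛 × ℝ => (o.2.1, o.1))
  exact (by fun_prop : Measurable fun o : 𝒲 × Bool × 𝓛 × ℝ => 2 * sgn o.2.1 / p).mul
    ((by fun_prop : Measurable fun o : 𝒲 × Bool × 𝓛 × ℝ => o.2.2.2).sub h1)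

lemma influence_observe (z : FullData 𝒲 𝓛) :
    influence P m (observe z) =
      ind (CY z) * resid (py P) m (core z) + (m true (W z) - m false (W z) - ate P) := by
  simp only [influence, obsY_observe, obsInd_observe, resid, core]
  simp only [observe]
  ring

lemma IsRegression.memLp_resid (hm : IsRegression P m) (hP : InModel P) :
    MemLp (fun z => resid (py P) m (core z)) 2 P := by
  have h : MemLp (fun z : FullData 𝒲 𝓛 => 2 / py P * (Y z - m (A z) (W z))) 2 P :=
    (hP.memLp.sub (hm.memLp_apply hP)).const_mul _
  refine h.mono ((measurable_resid _ hm.meas).comp measurable_core).aestronglyMeasurable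
    (ae_of_all _ fun z => ?_)
  have e : resid (py P) m (core z) = sgn (A z) * (2 / py P * (Y z - m (A z) (W z))) := by
    simp only [resid, core]; ring
  rw [e, norm_mul]
  exact mul_le_of_le_one_left (norm_nonneg _) (abs_sgn_le _)

lemma IsRegression.memLp_effect (hm : IsRegression P m) (hP : InModel P) :
    MemLp (fun z => m true (W z) - m false (W z) - ate P) 2 P := by
  have := hP.prob
  exact ((hm.memLp hP true).sub (hm.memLp hP false)).sub (memLp_const _)

lemma memLp_ind_mul {f : FullData 𝒲 𝓛 → ℝ} (hf : MemLp f 2 P) :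
    MemLp (fun z => ind (CY z) * f z) 2 P := by
  refine hf.mono ((by fun_prop : Measurable fun z : FullData 𝒲 𝓛 =>
    ind (CY z)).aestronglyMeasurable.mul hf.1) (ae_of_all _ fun z => ?_)
  rw [norm_mul]
  exact mul_le_of_le_one_left (norm_nonneg _) (abs_ind_le _)

lemma memLp_sgn_mul {f : FullData 𝒲 𝓛 → ℝ} (hf : MemLp f 2 P) :
    MemLp (fun z => sgn (A z) * f z) 2 P := by
  refine hf.mono ((by fun_prop : Measurable fun z : FullData 𝒲 𝓛 =>
    sgn (A z)).aestronglyMeasurable.mul hf.1) (ae_of_all _ fun z => ?_)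
  rw [norm_mul]
  exact mul_le_of_le_one_left (norm_nonneg _) (abs_sgn_le _)

lemma IsRegression.memLp_influence (hm : IsRegression P m) (hP : InModel P) :
    MemLp (influence P m) 2 (obsLaw P) := by
  rw [memLp_obsLaw_iff hm.measurable_influence]
  simp_rw [influence_observe]
  exact (memLp_ind_mul (hm.memLp_resid hP)).add (hm.memLp_effect hP)

/-- The value of the lower bound when `L` does not predict `Y` beyond `W`. -/
def boundValue (P : Measure (FullData 𝒲 𝓛)) : ℝ :=
  2 / py P * (sumVar P - ∑ a : Bool, variance (armCondY P a) P) + varEffect P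

lemma IsRegression.integral_resid_sq (hm : IsRegression P m) (hP : InModel P) :
    ∫ z, resid (py P) m (core z) ^ 2 ∂P =
      2 / py P ^ 2 * (sumVar P - ∑ a : Bool, variance (armCondY P a) P) := by
  have hp := hP.py_pos'.ne'
  have e : ∀ z : FullData 𝒲 𝓛, resid (py P) m (core z) ^ 2 =
      4 / py P ^ 2 * (Y z - m (A z) (W z)) ^ 2 := by
    intro z
    simp only [resid, core]
    have := sgn_mul_self (A z)
    calc _ = 4 / py P ^ 2 * (Y z - m (A z) (W z)) ^ 2 * (sgn (A z) * sgn (A z)) := by ring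
      _ = _ := by rw [this, mul_one]
  have hi : Integrable (fun z => (Y z - m (A z) (W z)) ^ 2) P :=
    (hP.memLp.sub (hm.memLp_apply hP)).integrable_sq
  have h : ∀ a, ∫ z in {z | A z = a}, (Y z - m (A z) (W z)) ^ 2 ∂P =
      ∫ z in {z | A z = a}, (Y z - m a (W z)) ^ 2 ∂P := fun a =>
    setIntegral_congr_fun (measurableSet_arm a) fun z hz => by
      simp only [Set.mem_ofPred_eq] at hz; simp [hz]
  simp_rw [e]
  rw [integral_const_mul, integral_eq_add_arms hi, h, h, hm.setIntegral_resid_sq hP,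
    hm.setIntegral_resid_sq hP, sumVar, Fintype.sum_bool, Fintype.sum_bool]
  ring

/-- Within each arm the residual is orthogonal to functions of W. This removes the cross term from
the second moment of the influence function. -/
lemma IsRegression.integral_resid_mul (hm : IsRegression P m) (hP : InModel P) {f : 𝒲 → ℝ}
    (hf : Measurable f) (hfL : MemLp (fun z => f (W z)) 2 P) :
    ∫ z, resid (py P) m (core z) * f (W z) ∂P = 0 := by
  have e : ∀ z : FullData 𝒲 𝓛, resid (py P) m (core z) * f (W z) =
      2 / py P * (sgn (A z) * (f (W z) * (Y z - m (A z) (W z)))) := by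
    intro z; simp only [resid, core]; ring
  have h : ∀ a, ∫ z in {z | A z = a}, f (W z) * (Y z - m (A z) (W z)) ∂P =
      ∫ z in {z | A z = a}, f (W z) * (Y z - m a (W z)) ∂P := fun a =>
    setIntegral_congr_fun (measurableSet_arm a) fun z hz => by
      simp only [Set.mem_ofPred_eq] at hz; simp [hz]
  simp_rw [e]
  have hi : Integrable (fun z => f (W z) * (Y z - m (A z) (W z))) P :=
    hfL.integrable_mul (hP.memLp.sub (hm.memLp_apply hP))
  rw [integral_const_mul, integral_sgn_mul hi, h, h, hm.setIntegral_mul_resid hP _ hf hfL,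
    hm.setIntegral_mul_resid hP _ hf hfL]
  simp

lemma IsRegression.varEffect_eq (hm : IsRegression P m) (hP : InModel P) :
    varEffect P = ∫ z, (m true (W z) - m false (W z) - ate P) ^ 2 ∂P := by
  have h : (fun z => armCondY P true z - armCondY P false z) =
      fun z => m true (W z) - m false (W z) := by
    ext z; simp [hm.eq]
  rw [varEffect, h, variance_eq_integral, hm.ate_eq hP]
  exact (((hm.meas true).comp measurable_W).sub ((hm.meas false).comp measurable_W)).aemeasurable

/-- Independent censoring multiplies the residual term by p, turning 2/p² into 2/p; the cross term
vanishes and the effect term contributes its variance. -/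
lemma IsRegression.integral_influence_sq (hm : IsRegression P m) (hP : InModel P) :
    ∫ o, influence P m o ^ 2 ∂(obsLaw P) = boundValue P := by
  have hp := hP.py_pos'.ne'
  rw [integral_obsLaw (φ := fun o => influence P m o ^ 2) (hm.measurable_influence.pow_const 2)]
  have hR := hm.memLp_resid hP
  have hB := hm.memLp_effect hP
  have hr := measurable_resid (𝓛 := 𝓛) (py P) hm.meas
  have hbm : Measurable fun w => m true w - m false w - ate P :=
    ((hm.meas true).sub (hm.meas false)).sub_const _
  set r := (resid (py P) m : 𝒲 × Bool × 𝓛 × ℝ → ℝ) with hr_def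
  have e : ∀ z : FullData 𝒲 𝓛, influence P m (observe z) ^ 2 =
      (ind (CY z) * r (core z) ^ 2 +
        2 * (ind (CY z) * (r (core z) * (m true (W z) - m false (W z) - ate P)))) +
        (m true (W z) - m false (W z) - ate P) ^ 2 := by
    intro z
    rw [influence_observe]
    have := ind_mul_self (CY z)
    calc _ = (ind (CY z) * ind (CY z)) * r (core z) ^ 2 +
        2 * (ind (CY z) * (r (core z) * (m true (W z) - m false (W z) - ate P))) +
        (m true (W z) - m false (W z) - ate P) ^ 2 := by ring
      _ = _ := by rw [this]
  have i1 : Integrable (fun z => ind (CY z) * r (core z) ^ 2) P :=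
    hR.integrable_sq.bdd_mul (c := 1) (by fun_prop) (ae_of_all _ fun z => abs_ind_le _)
  have i2 : Integrable (fun z => 2 * (ind (CY z) *
      (r (core z) * (m true (W z) - m false (W z) - ate P)))) P :=
    ((hR.integrable_mul hB).bdd_mul (c := 1) (by fun_prop)
      (ae_of_all _ fun z => abs_ind_le _)).const_mul 2
  have i12 : Integrable (fun z => ind (CY z) * r (core z) ^ 2 + 2 * (ind (CY z) *
      (r (core z) * (m true (W z) - m false (W z) - ate P)))) P := i1.add i2
  simp_rw [e]
  rw [integral_add i12 hB.integrable_sq, integral_add i1 i2, integral_const_mul,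
    hP.integral_CY_mul_core (k := fun x => r x ^ 2) (hr.pow_const 2),
    show ∫ z, ind (CY z) * (r (core z) * (m true (W z) - m false (W z) - ate P)) ∂P =
      py P * ∫ z, r (core z) * (m true (W z) - m false (W z) - ate P) ∂P from
      hP.integral_CY_mul_core (k := fun x => r x * (m true x.1 - m false x.1 - ate P))
        (hr.mul (hbm.comp measurable_fst)), hr_def, hm.integral_resid_sq hP,
    hm.integral_resid_mul hP hbm hB, boundValue, hm.varEffect_eq hP]
  field_simp
  ring

/-- The average treatment effect in terms of the observed data law. -/
lemma InModel.ate_eq_div {Q : Measure (FullData 𝒲 𝓛)} (hQ : InModel Q) :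
    ate Q = 2 * (∫ o, sgn o.2.1 * obsY o.2.2.2 ∂(obsLaw Q)) / ∫ o, obsInd o.2.2.2 ∂(obsLaw Q) := by
  rw [integral_obsLaw (φ := fun o => sgn o.2.1 * obsY o.2.2.2) (by fun_prop),
    integral_obsLaw (φ := fun o => obsInd o.2.2.2) (by fun_prop)]
  simp_rw [obsInd_observe, obsY_observe]
  have e : ∀ z : FullData 𝒲 𝓛, sgn (observe z).2.1 * (ind (CY z) * Y z) =
      ind (CY z) * (sgn (A z) * Y z) := fun z => by simp only [observe]; ring
  simp_rw [e]
  have h := hQ.integral_CY_mul_core (k := fun x => sgn x.2.1 * x.2.2.2) (by fun_prop)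
  simp only [core] at h
  rw [h, integral_ind_CY, integral_sgn_mul hQ.integrable_Y, ate, hQ.integral_armLaw,
    hQ.integral_armLaw]
  have hp := hQ.py_pos'.ne'
  field_simp

lemma InModel.integrable_obsY (hP : InModel P) :
    Integrable (fun o => sgn o.2.1 * obsY o.2.2.2) (obsLaw P) := by
  rw [integrable_obsLaw_iff (by fun_prop)]
  simp_rw [obsY_observe]
  exact (hP.integrable_Y.bdd_mul (c := 1) (by fun_prop) (ae_of_all _ fun z => abs_ind_le _)).bdd_mul
    (c := 1) (by simp only [observe]; fun_prop) (ae_of_all _ fun z => abs_sgn_le _)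

lemma InModel.integrable_obsInd (hP : InModel P) :
    Integrable (fun o => obsInd o.2.2.2) (obsLaw P) := by
  have := hP.prob
  rw [integrable_obsLaw_iff (by fun_prop)]
  simp_rw [obsInd_observe]
  exact Integrable.of_bound (by fun_prop) 1 (ae_of_all _ fun z => abs_ind_le _)

lemma integral_obsInd : ∫ o, obsInd o.2.2.2 ∂(obsLaw P) = py P := by
  rw [integral_obsLaw (φ := fun o => obsInd o.2.2.2) (by fun_prop)]
  simp_rw [obsInd_observe]
  exact integral_ind_CY

lemma InModel.integral_sgn_obsY (hP : InModel P) :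
    2 * (∫ o, sgn o.2.1 * obsY o.2.2.2 ∂(obsLaw P)) = ate P * py P := by
  have h := hP.ate_eq_div
  rw [integral_obsInd] at h
  rw [h]
  have hp := hP.py_pos'.ne'
  field_simp

section Submodel

variable {Pt : ℝ → Measure (FullData 𝒲 𝓛)} {s : Obs 𝒲 𝓛 → ℝ}

lemma IsSubmodel.hasDerivAt_integral (h : IsSubmodel P Pt s) {φ : Obs 𝒲 𝓛 → ℝ}
    (hφ : Integrable φ (obsLaw P)) :
    HasDerivAt (fun t => ∫ o, φ o ∂(obsLaw (Pt t))) (∫ o, s o * φ o ∂(obsLaw P)) 0 := by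
  obtain ⟨C, hC⟩ := h.score_bounded
  obtain ⟨g, hg, hd, ha⟩ := h.density
  exact hasDerivAt_integral_of_density (νt := fun t => obsLaw (Pt t)) (by rw [h.at_zero]) hg
    h.score_measurable hC hd ha hφ

lemma IsSubmodel.integrable_score_mul (h : IsSubmodel P Pt s) {φ : Obs 𝒲 𝓛 → ℝ}
    (hφ : Integrable φ (obsLaw P)) : Integrable (fun o => s o * φ o) (obsLaw P) := by
  obtain ⟨C, hC⟩ := h.score_bounded
  exact hφ.bdd_mul (c := C) h.score_measurable.aestronglyMeasurable hC

/-- The total mass is constantly 1 along the path. -/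
lemma IsSubmodel.integral_score (h : IsSubmodel P Pt s) (hP : InModel P) :
    ∫ o, s o ∂(obsLaw P) = 0 := by
  have := hP.isProbabilityMeasure_obsLaw
  have h1 := h.hasDerivAt_integral (φ := fun _ => 1) (integrable_const 1)
  have h2 : HasDerivAt (fun t => ∫ _, (1 : ℝ) ∂(obsLaw (Pt t))) 0 0 := by
    refine (hasDerivAt_const (0 : ℝ) (1 : ℝ)).congr_of_eventuallyEq ?_
    filter_upwards [h.in_model] with t ht
    have := ht.isProbabilityMeasure_obsLaw
    simp
  simpa using h1.unique h2

/-- Scores are orthogonal to `(2 A - 1) f(W)`, because of randomization. -/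
lemma IsSubmodel.integral_score_sgn (h : IsSubmodel P Pt s) {f : 𝒲 → ℝ} (hf : Measurable f)
    (hi : Integrable (fun z => f (W z)) P) :
    ∫ o, s o * (sgn o.2.1 * f o.1) ∂(obsLaw P) = 0 := by
  have hm : Measurable fun o : Obs 𝒲 𝓛 => sgn o.2.1 * f o.1 :=
    (by fun_prop : Measurable fun o : Obs 𝒲 𝓛 => sgn o.2.1).mul (hf.comp measurable_fst)
  have hint : ∀ Q : Measure (FullData 𝒲 𝓛), Integrable (fun z => f (W z)) Q →
      Integrable (fun o => sgn o.2.1 * f o.1) (obsLaw Q) := by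
    intro Q hQ
    rw [integrable_obsLaw_iff hm]
    exact hQ.bdd_mul (c := 1) (f := fun z : FullData 𝒲 𝓛 => sgn (A z)) (by fun_prop)
      (ae_of_all _ fun z => abs_sgn_le _)
  refine (h.hasDerivAt_integral (hint P hi)).unique ?_
  refine (hasDerivAt_const (0 : ℝ) (0 : ℝ)).congr_of_eventuallyEq ?_
  filter_upwards [h.in_model] with t ht
  have hp := ht.prob
  rw [integral_obsLaw hm]
  -- Factoring through independence avoids asking whether f(W) is integrable under `Pt t`; the
  -- factor for the sign is zero.
  have h1 := ht.randomization.integral_fun_comp_mul_comp (f := sgn) (g := f)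
    measurable_A.aemeasurable measurable_W.aemeasurable
    Measurable.of_discrete.aestronglyMeasurable hf.aestronglyMeasurable
  have h2 := ht.integral_sgn_W (f := fun _ => 1) measurable_const (integrable_const 1)
  simp only [mul_one] at h2
  rw [h2, zero_mul] at h1
  exact h1

/-- The constraint on scores that comes from independent censoring. -/
lemma IsSubmodel.integral_score_censor (h : IsSubmodel P Pt s) (hP : InModel P)
    {k : Bool × 𝒲 → ℝ} (hk : Measurable k) (hi : Integrable (fun z => k (A z, W z)) P) :
    ∫ o, s o * (obsInd o.2.2.2 * k (o.2.1, o.1)) ∂(obsLaw P) =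
      (∫ o, s o * obsInd o.2.2.2 ∂(obsLaw P)) * (∫ z, k (A z, W z) ∂P) +
        py P * ∫ o, s o * k (o.2.1, o.1) ∂(obsLaw P) := by
  have hkm : Measurable fun o : Obs 𝒲 𝓛 => k (o.2.1, o.1) :=
    hk.comp (by fun_prop : Measurable fun o : Obs 𝒲 𝓛 => (o.2.1, o.1))
  have hIm : Measurable fun o : Obs 𝒲 𝓛 => obsInd o.2.2.2 := by fun_prop
  have hIk : Measurable fun o : Obs 𝒲 𝓛 => obsInd o.2.2.2 * k (o.2.1, o.1) := hIm.mul hkm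
  have hk1 : Integrable (fun o => k (o.2.1, o.1)) (obsLaw P) :=
    (integrable_obsLaw_iff hkm).2 hi
  have hk2 : Integrable (fun o => obsInd o.2.2.2 * k (o.2.1, o.1)) (obsLaw P) := by
    rw [integrable_obsLaw_iff hIk]
    simp_rw [obsInd_observe]
    exact hi.bdd_mul (c := 1) (by fun_prop) (ae_of_all _ fun z => abs_ind_le _)
  have d1 := h.hasDerivAt_integral hk1
  have d2 := h.hasDerivAt_integral hk2
  have d3 := h.hasDerivAt_integral hP.integrable_obsInd
  -- Along the path E(C^Y k) = E(C^Y) E(k); differentiate both sides, with the product rule on the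
  -- right.
  have d4 := d3.mul d1
  refine (d2.unique (d4.congr_of_eventuallyEq ?_)).trans ?_
  · filter_upwards [h.in_model] with t ht
    simp only [Pi.mul_apply]
    rw [integral_obsLaw hIk, integral_obsInd, integral_obsLaw hkm]
    simp_rw [obsInd_observe]
    exact ht.integral_CY_mul_core (k := fun x => k (x.2.1, x.1))
      (hk.comp (by fun_prop : Measurable fun x : 𝒲 × Bool × 𝓛 × ℝ => (x.2.1, x.1)))
  · simp only [h.at_zero]
    rw [integral_obsInd, integral_obsLaw hkm]
    rfl

/-- Pathwise differentiability of the average treatment effect. -/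
lemma IsSubmodel.hasDerivAt_ate (h : IsSubmodel P Pt s) (hP : InModel P)
    (hm : IsRegression P m) :
    HasDerivAt (fun t => ate (Pt t)) (∫ o, s o * influence P m o ∂(obsLaw P)) 0 := by
  have hp := hP.py_pos'.ne'
  have hprob := hP.prob
  have hiY := hP.integrable_obsY
  have hiI := hP.integrable_obsInd
  have d1 := (h.hasDerivAt_integral hiY).const_mul 2
  have d2 := h.hasDerivAt_integral hiI
  have hne : ∫ o, obsInd o.2.2.2 ∂(obsLaw (Pt 0)) ≠ 0 := by
    rw [h.at_zero, integral_obsInd]; exact hp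
  -- The quotient rule gives the derivative of Δ as (2/p) E(s (2A-1) C^Y Y) - (Δ/p) E(s C^Y). The
  -- constraints on s must turn this into E(sφ).
  have d3 := d1.div d2 hne
  refine (d3.congr_of_eventuallyEq ?_).congr_deriv ?_
  · filter_upwards [h.in_model] with t ht
    exact ht.ate_eq_div
  simp only [h.at_zero]
  rw [hP.integral_sgn_obsY, integral_obsInd]
  have hM : Measurable fun x : Bool × 𝒲 => sgn x.1 * m x.1 x.2 :=
    (by fun_prop : Measurable fun x : Bool × 𝒲 => sgn x.1).mul (measurable_arm_apply hm.meas)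
  have hMi : Integrable (fun z => sgn (A z) * m (A z) (W z)) P :=
    (memLp_sgn_mul (hm.memLp_apply hP)).integrable (by norm_num)
  have hMI : Integrable (fun o => obsInd o.2.2.2 * (sgn o.2.1 * m o.2.1 o.1)) (obsLaw P) := by
    have hkm : Measurable fun o : Obs 𝒲 𝓛 => sgn o.2.1 * m o.2.1 o.1 :=
      hM.comp (by fun_prop : Measurable fun o : Obs 𝒲 𝓛 => (o.2.1, o.1))
    have hIk : Measurable fun o : Obs 𝒲 𝓛 => obsInd o.2.2.2 * (sgn o.2.1 * m o.2.1 o.1) :=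
      (by fun_prop : Measurable fun o : Obs 𝒲 𝓛 => obsInd o.2.2.2).mul hkm
    rw [integrable_obsLaw_iff hIk]
    simp_rw [obsInd_observe]
    exact hMi.bdd_mul (c := 1) (by fun_prop) (ae_of_all _ fun z => abs_ind_le _)
  -- Taking k = (2A-1) m_A, whose mean is Δ/2, trades the term in E(s C^Y) for terms in m.
  have c1 := h.integral_score_censor hP hM hMi
  simp only at c1
  have hmi : ∀ a, Integrable (fun z => m a (W z)) P := fun a =>
    (hm.memLp hP a).integrable (by norm_num)
  have hmo : ∀ a, Integrable (fun o => m a o.1) (obsLaw P) := fun a =>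
    (integrable_obsLaw_iff ((hm.meas a).comp measurable_fst)).2 (hmi a)
  have c2 := h.integral_score_sgn ((hm.meas true).add (hm.meas false))
    ((hmi true).add (hmi false))
  simp only [Pi.add_apply] at c2
  have c3 : ∫ z, sgn (A z) * m (A z) (W z) ∂P = ate P / 2 := by
    have e : ∀ z : FullData 𝒲 𝓛, sgn (A z) * m (A z) (W z) =
        (m true (W z) - m false (W z)) / 2 + sgn (A z) * ((m true (W z) + m false (W z)) / 2) := by
      intro z; cases A z <;> simp [sgn] <;> ring
    have i1 : Integrable (fun z => (m true (W z) + m false (W z)) / 2) P :=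
      ((hmi true).add (hmi false)).div_const 2
    have i2 : Integrable (fun z => (m true (W z) - m false (W z)) / 2) P :=
      ((hmi true).sub (hmi false)).div_const 2
    simp_rw [e]
    rw [integral_add i2 (i1.bdd_mul (c := 1) (by fun_prop) (ae_of_all _ fun z => abs_sgn_le _)),
      integral_div, ← hm.ate_eq hP,
      hP.integral_sgn_W (f := fun w => (m true w + m false w) / 2)
        (((hm.meas true).add (hm.meas false)).div_const 2) i1, add_zero]
  have c4 := h.integral_score hP
  rw [c3] at c1
  -- Uses m_1 - m_0 = 2 (2A-1) m_A - (2A-1)(m_1 + m_0), whose last term is orthogonal to every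
  -- score.
  have e : ∀ o : Obs 𝒲 𝓛, s o * influence P m o =
      ((2 / py P * (s o * (sgn o.2.1 * obsY o.2.2.2)) -
        2 / py P * (s o * (obsInd o.2.2.2 * (sgn o.2.1 * m o.2.1 o.1)))) +
      (2 * (s o * (sgn o.2.1 * m o.2.1 o.1)) -
        s o * (sgn o.2.1 * (m true o.1 + m false o.1)))) - ate P * s o := by
    intro o
    rw [influence]
    rcases o with ⟨w, a, l, y⟩
    cases a <;> simp [sgn] <;> ring
  have hsi : Integrable s (obsLaw P) := by
    have := hP.isProbabilityMeasure_obsLaw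
    simpa using h.integrable_score_mul (φ := fun _ => 1) (integrable_const 1)
  have hMo : Integrable (fun o => sgn o.2.1 * m o.2.1 o.1) (obsLaw P) :=
    (integrable_obsLaw_iff (hM.comp
      (by fun_prop : Measurable fun o : Obs 𝒲 𝓛 => (o.2.1, o.1)))).2 hMi
  have j1 := (h.integrable_score_mul hiY).const_mul (2 / py P)
  have j2 := (h.integrable_score_mul hMI).const_mul (2 / py P)
  have j3 := (h.integrable_score_mul hMo).const_mul 2
  have j4 : Integrable (fun o => s o * (sgn o.2.1 * (m true o.1 + m false o.1))) (obsLaw P) :=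
    h.integrable_score_mul (((hmo true).add (hmo false)).bdd_mul (c := 1)
      (by fun_prop : Measurable fun o : Obs 𝒲 𝓛 => sgn o.2.1).aestronglyMeasurable
      (ae_of_all _ fun z => abs_sgn_le _))
  have j12 : Integrable (fun o => 2 / py P * (s o * (sgn o.2.1 * obsY o.2.2.2)) -
        2 / py P * (s o * (obsInd o.2.2.2 * (sgn o.2.1 * m o.2.1 o.1)))) (obsLaw P) := j1.sub j2
  have j34 : Integrable (fun o => 2 * (s o * (sgn o.2.1 * m o.2.1 o.1)) -
        s o * (sgn o.2.1 * (m true o.1 + m false o.1))) (obsLaw P) := j3.sub j4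
  have j1234 : Integrable (fun o => (2 / py P * (s o * (sgn o.2.1 * obsY o.2.2.2)) -
        2 / py P * (s o * (obsInd o.2.2.2 * (sgn o.2.1 * m o.2.1 o.1)))) +
      (2 * (s o * (sgn o.2.1 * m o.2.1 o.1)) -
        s o * (sgn o.2.1 * (m true o.1 + m false o.1)))) (obsLaw P) := j12.add j34
  simp_rw [e]
  rw [integral_sub j1234 (hsi.const_mul _), integral_add j12 j34, integral_sub j1 j2,
    integral_sub j3 j4, integral_const_mul, integral_const_mul, integral_const_mul,
    integral_const_mul, c1, c2, c4]
  field_simp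
  ring

lemma IsSubmodel.memLp_score (h : IsSubmodel P Pt s) (hP : InModel P) : MemLp s 2 (obsLaw P) := by
  have := hP.isProbabilityMeasure_obsLaw
  obtain ⟨C, hC⟩ := h.score_bounded
  exact MemLp.of_bound h.score_measurable.aestronglyMeasurable C hC

end Submodel

/-- The Cauchy-Schwarz inequality for square-integrable functions. -/
lemma sq_integral_mul_le {Ω : Type*} [MeasurableSpace Ω] {ν : Measure Ω} {f g : Ω → ℝ}
    (hf : MemLp f 2 ν) (hg : MemLp g 2 ν) :
    (∫ o, f o * g o ∂ν) ^ 2 ≤ (∫ o, f o ^ 2 ∂ν) * ∫ o, g o ^ 2 ∂ν := by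
  have hfg : Integrable (fun o => f o * g o) ν := hf.integrable_mul hg
  have key : ∀ x : ℝ, 0 ≤ (∫ o, f o ^ 2 ∂ν) * (x * x) + (2 * ∫ o, f o * g o ∂ν) * x +
      ∫ o, g o ^ 2 ∂ν := by
    intro x
    have e : ∫ o, (x * f o + g o) ^ 2 ∂ν = (∫ o, f o ^ 2 ∂ν) * (x * x) +
        (2 * ∫ o, f o * g o ∂ν) * x + ∫ o, g o ^ 2 ∂ν := by
      have e1 : ∀ o, (x * f o + g o) ^ 2 = x * x * f o ^ 2 + 2 * x * (f o * g o) + g o ^ 2 :=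
        fun o => by ring
      have i1 : Integrable (fun o => x * x * f o ^ 2 + 2 * x * (f o * g o)) ν :=
        (hf.integrable_sq.const_mul _).add (hfg.const_mul _)
      simp_rw [e1]
      rw [integral_add i1 hg.integrable_sq, integral_add (hf.integrable_sq.const_mul _)
        (hfg.const_mul _), integral_const_mul, integral_const_mul]
      ring
    rw [← e]
    exact integral_nonneg fun o => sq_nonneg _
  have := discrim_le_zero key
  rw [discrim] at this
  linarith

/-- Cauchy-Schwarz for E(sφ). The inequality holds even if L is informative, in which case φ need
not be a limit of scores. -/
lemma efficiencyBound_le (hP : InModel P) : efficiencyBound P ≤ ENNReal.ofReal (boundValue P) := by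
  obtain ⟨m, hm⟩ := exists_isRegression P
  refine sSup_le ?_
  rintro b ⟨Pt, s, d, hs, hd, rfl⟩
  have e := hd.unique (hs.hasDerivAt_ate hP hm)
  have h := sq_integral_mul_le (hs.memLp_score hP) (hm.memLp_influence hP)
  rw [← e, hm.integral_influence_sq hP, mul_comm] at h
  refine ENNReal.div_le_of_le_mul ?_
  have hV : 0 ≤ boundValue P := by
    rw [← hm.integral_influence_sq hP]
    exact integral_nonneg fun o => sq_nonneg _
  rw [← ENNReal.ofReal_mul hV]
  exact ENNReal.ofReal_le_ofReal h

end

/-! ### Bounded approximation under a conditional mean constraint -/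

lemma integral_sq_le_of_eLpNorm_le {Ω : Type*} [MeasurableSpace Ω] {ν : Measure Ω} {f : Ω → ℝ}
    (hf : MemLp f 2 ν) {c : ℝ} (hc : 0 ≤ c) (h : eLpNorm f 2 ν ≤ ENNReal.ofReal c) :
    ∫ o, f o ^ 2 ∂ν ≤ c ^ 2 := by
  have hn : 0 ≤ ∫ o, f o ^ 2 ∂ν := integral_nonneg fun o => sq_nonneg _
  rw [hf.eLpNorm_eq_integral_rpow_norm (by norm_num) (by norm_num),
    ENNReal.ofReal_le_ofReal_iff hc] at h
  have e : ∫ a, ‖f a‖ ^ (2 : ℝ≥0∞).toReal ∂ν = ∫ o, f o ^ 2 ∂ν := by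
    congr 1; ext a; simp
  rw [e] at h
  have h2 := pow_le_pow_left₀ (by positivity) h 2
  have e2 : ((∫ o, f o ^ 2 ∂ν) ^ ((2 : ℝ≥0∞).toReal)⁻¹) ^ 2 = ∫ o, f o ^ 2 ∂ν := by
    rw [← Real.rpow_natCast, ← Real.rpow_mul hn]; simp
  rwa [e2] at h2

/-- A square-integrable function of `X` with conditional mean zero given `π(X)` is approximated in
`L²` by bounded functions with the same property. -/
lemma exists_bounded_approx {Ω 𝒳 𝒵 : Type*} {𝓜 mΩ : MeasurableSpace Ω} [MeasurableSpace 𝒳]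
    [m𝒵 : MeasurableSpace 𝒵] {P : Measure Ω} [IsProbabilityMeasure P] {X : Ω → 𝒳} (hX : Measurable X)
    {π : 𝒳 → 𝒵} (hπ : Measurable π) {ρ : 𝒳 → ℝ} (hρ : Measurable ρ)
    (hL : MemLp (fun z => ρ (X z)) 2 P)
    (h𝓜 : 𝓜 = MeasurableSpace.comap (fun z => π (X z)) m𝒵)
    (h0 : ∀ B, MeasurableSet B → ∫ z in {z | π (X z) ∈ B}, ρ (X z) ∂P = 0)
    {ε : ℝ≥0∞} (hε : ε ≠ 0) :
    ∃ (r : 𝒳 → ℝ) (C : ℝ), Measurable r ∧ (∀ᵐ z ∂P, |r (X z)| ≤ C) ∧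
      (∀ B, MeasurableSet B → ∫ z in {z | π (X z) ∈ B}, r (X z) ∂P = 0) ∧
      eLpNorm (fun z => r (X z) - ρ (X z)) 2 P ≤ ε + ε := by
  have hle : 𝓜 ≤ mΩ := h𝓜.trans_le (measurable_iff_comap_le.1 (hπ.comp hX))
  have hL' : MemLp ρ 2 (P.map X) :=
    (memLp_map_measure_iff hρ.aestronglyMeasurable hX.aemeasurable).2 hL
  obtain ⟨g, hg, hgL⟩ := hL'.exists_simpleFunc_eLpNorm_sub_lt (by norm_num) hε
  have hgL2 : MemLp (fun z => g (X z)) 2 P :=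
    (memLp_map_measure_iff g.measurable.aestronglyMeasurable hX.aemeasurable).1 hgL
  have hgi : Integrable (fun z => g (X z)) P := hgL2.integrable (by norm_num)
  have hρi : Integrable (fun z => ρ (X z)) P := hL.integrable (by norm_num)
  -- The simple function g approximates ρ but breaks the constraint; subtracting its conditional
  -- mean k(π(X)) restores it and keeps it bounded.
  obtain ⟨k, hk, hke⟩ := StronglyMeasurable.exists_eq_measurable_comp
    (f := fun z => π (X z)) (g := P[fun z => g (X z) | 𝓜])
    (by rw [← h𝓜]; exact stronglyMeasurable_condExp)
  obtain ⟨C, hC⟩ := g.exists_forall_norm_le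
  have hCb : ∀ᵐ z ∂P, |(P[fun z => g (X z) | 𝓜]) z| ≤ C.toNNReal :=
    ae_bdd_abs_condExp_of_ae_bdd_abs (ae_of_all _ fun z => (hC (X z)).trans (Real.le_coe_toNNReal C))
  have hcond : P[fun z => ρ (X z) | 𝓜] =ᵐ[P] 0 := by
    refine (ae_eq_condExp_of_forall_setIntegral_eq hle hρi (fun s _ _ => integrableOn_zero) ?_
      stronglyMeasurable_zero.aestronglyMeasurable).symm
    intro s hs _
    rw [h𝓜] at hs
    obtain ⟨B, hB, rfl⟩ := hs
    simp only [integral_zero]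
    exact (h0 B hB).symm
  refine ⟨fun x => g x - k (π x), C + C.toNNReal, g.measurable.sub (hk.measurable.comp hπ), ?_,
    ?_, ?_⟩
  · filter_upwards [hCb] with z hz
    rw [hke] at hz
    exact (abs_sub _ _).trans (add_le_add (hC _) hz)
  · intro B hB
    have e : (fun z => g (X z) - k (π (X z))) =
        fun z => g (X z) - (P[fun z => g (X z) | 𝓜]) z := by
      rw [hke]; rfl
    rw [e, integral_sub hgi.integrableOn integrable_condExp.integrableOn,
      setIntegral_condExp hle hgi (by rw [h𝓜]; exact ⟨B, hB, rfl⟩), sub_self]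
  -- As E(ρ | π) = 0, the error is the sum of -(ρ - g) and the conditional mean of ρ - g. The latter
  -- is no larger in L², whence ε + ε.
  · have e1 : (fun z => g (X z) - k (π (X z)) - ρ (X z)) =ᵐ[P]
        -(fun z => ρ (X z) - g (X z)) + P[fun z => ρ (X z) - g (X z) | 𝓜] := by
      have h1 := condExp_sub hρi hgi 𝓜
      filter_upwards [h1, hcond] with z hz1 hz2
      have h2 : (P[fun z => g (X z) | 𝓜]) z = k (π (X z)) := congrFun hke z
      have h3 : (P[fun z => ρ (X z) - g (X z) | 𝓜]) z = - k (π (X z)) := by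
        have : (P[fun z => ρ (X z) - g (X z) | 𝓜]) z = _ := hz1
        rw [this, Pi.sub_apply, hz2, h2]; simp
      simp only [Pi.add_apply, Pi.neg_apply, h3]
      ring
    have hd : MemLp (fun z => ρ (X z) - g (X z)) 2 P := hL.sub hgL2
    have e2 : eLpNorm (fun z => ρ (X z) - g (X z)) 2 P ≤ ε := by
      exact (eLpNorm_map_measure (g := fun x => ρ x - g x)
        (hρ.sub g.measurable).aestronglyMeasurable hX.aemeasurable).symm.trans_le hg.le
    rw [eLpNorm_congr_ae e1]
    refine (eLpNorm_add_le hd.neg.1 integrable_condExp.1 (by norm_num)).trans ?_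
    rw [eLpNorm_neg]
    exact add_le_add e2 ((eLpNorm_condExp_le_eLpNorm _ (by norm_num)).trans e2)

/-! ### Construction of submodels -/

section

variable {𝒲 𝓛 : Type*} [MeasurableSpace 𝒲] [MeasurableSpace 𝓛] {P : Measure (FullData 𝒲 𝓛)}
  {m : Bool → 𝒲 → ℝ}

/-- Reweighting the law of `(W, A, L, Y)` by a bounded density that keeps the randomization stays
in the model. -/
lemma InModel.withDensity (hP : InModel P) {D : 𝒲 × Bool × 𝓛 × ℝ → ℝ≥0∞} (hD : Measurable D)
    (h1 : ∫⁻ z, D (core z) ∂P = 1) (h2 : ∀ᵐ z ∂P, D (core z) ≤ 2)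
    (h3 : ∀ B V, MeasurableSet V → ∫⁻ z in A ⁻¹' B ∩ W ⁻¹' V, D (core z) ∂P =
      P (A ⁻¹' B) * ∫⁻ z in W ⁻¹' V, D (core z) ∂P) :
    InModel (P.withDensity fun z => D (core z)) := by
  have hprob := hP.prob
  set Q := P.withDensity fun z => D (core z) with hQ
  have hDc : Measurable fun z : FullData 𝒲 𝓛 => D (core z) := hD.comp measurable_core
  have hQprob : IsProbabilityMeasure Q := by
    exact ⟨by rw [hQ, withDensity_apply _ MeasurableSet.univ, Measure.restrict_univ, h1]⟩
  have hac : Q ≪ P := withDensity_absolutelyContinuous _ _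
  -- This is what keeps Y square-integrable under the new law.
  have hle : Q ≤ (2 : ℝ≥0∞) • P := by
    rw [← withDensity_const]
    exact withDensity_mono h2
  have hA : ∀ B : Set Bool, Q (A ⁻¹' B) = P (A ⁻¹' B) := by
    intro B
    have := h3 B Set.univ MeasurableSet.univ
    simp only [Set.preimage_univ, Set.inter_univ, Measure.restrict_univ, h1, mul_one] at this
    rw [hQ, withDensity_apply _ (measurable_A (MeasurableSet.of_discrete)), this]
  -- The density depends on (W, A, L, Y) only, so reweighting leaves the censoring law and its
  -- independence intact.
  have hC : ∀ (c : Set (Bool × Bool)) (B : Set (𝒲 × Bool × 𝓛 × ℝ)), MeasurableSet B →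
      Q ((fun z => (CL z, CY z)) ⁻¹' c ∩ core ⁻¹' B) =
        P ((fun z => (CL z, CY z)) ⁻¹' c) * Q (core ⁻¹' B) := by
    intro c B hB
    have hCm : Measurable fun z : FullData 𝒲 𝓛 => (CL z, CY z) := by fun_prop
    have hc : MeasurableSet c := MeasurableSet.of_discrete
    have h := lintegral_mul_eq_lintegral_mul_lintegral_of_indepFun''
      (f := fun z : FullData 𝒲 𝓛 => c.indicator (fun _ => (1 : ℝ≥0∞)) (CL z, CY z))
      (g := fun z => B.indicator D (core z)) (μ := P)
      ((measurable_const.indicator hc).comp hCm).aemeasurable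
      ((hD.indicator hB).comp measurable_core).aemeasurable
      (hP.independent_censoring.comp (φ := c.indicator fun _ => (1 : ℝ≥0∞))
        (ψ := B.indicator D) (measurable_const.indicator hc) (hD.indicator hB))
    have e1 : ∫⁻ z, c.indicator (fun _ => (1 : ℝ≥0∞)) (CL z, CY z) ∂P =
        P ((fun z => (CL z, CY z)) ⁻¹' c) := by
      rw [← lintegral_indicator_one (hCm hc)]; rfl
    have e2 : ∫⁻ z, B.indicator D (core z) ∂P = Q (core ⁻¹' B) := by
      rw [hQ, withDensity_apply _ (measurable_core hB),
        ← lintegral_indicator (measurable_core hB)]; rfl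
    rw [← e1, ← e2, ← h, hQ, withDensity_apply _ ((hCm hc).inter (measurable_core hB)),
      ← lintegral_indicator ((hCm hc).inter (measurable_core hB))]
    congr 1; ext z
    by_cases hz1 : (CL z, CY z) ∈ c <;> by_cases hz2 : core z ∈ B <;>
      simp [Set.indicator, hz1, hz2]
  have hC' : ∀ c : Set (Bool × Bool), Q ((fun z => (CL z, CY z)) ⁻¹' c) =
      P ((fun z => (CL z, CY z)) ⁻¹' c) := by
    intro c
    have := hC c Set.univ MeasurableSet.univ
    simpa using this
  refine ⟨hQprob, hP.memLp.of_measure_le_smul (by norm_num) hle, ?_, ?_, ?_, ?_, ?_⟩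
  · rw [indepFun_iff_measure_inter_preimage_eq_mul]
    intro B V hB hV
    rw [hA, hQ, withDensity_apply _ ((measurable_A hB).inter (measurable_W hV)),
      withDensity_apply _ (measurable_W hV), h3 B V hV]
  · have := hA {true}
    exact this.trans hP.half
  · rw [indepFun_iff_measure_inter_preimage_eq_mul]
    intro c B _ hB
    rw [hC']
    exact hC c B hB
  · exact hac.ae_le hP.monotone_censoring
  · have := hC' {c | c.2 = true}
    exact hP.py_pos.trans_eq this.symm

/-- When Y is missing, the observation is a function of (W, A, L) and C^L, and r has mean zero given
(W, A, L). Hence perturbing the law of Y by r is invisible in the observed data unless C^Y = 1. -/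
lemma InModel.setIntegral_uncensored (hP : InModel P) {r : 𝒲 × Bool × 𝓛 × ℝ → ℝ} (hr : Measurable r)
    (hri : Integrable (fun z => r (core z)) P)
    (hr0 : ∀ B : Set (𝒲 × Bool × 𝓛), MeasurableSet B →
      ∫ z in {z | (W z, A z, L z) ∈ B}, r (core z) ∂P = 0)
    {B : Set (Obs 𝒲 𝓛)} (hB : MeasurableSet B) :
    ∫ z in observe ⁻¹' B, (1 - ind (CY z)) * r (core z) ∂P = 0 := by
  have hprob := hP.prob
  -- The observation of a participant with C^L = c and C^Y = 0.
  set j : Bool → 𝒲 × Bool × 𝓛 → Obs 𝒲 𝓛 := fun c x =>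
    (x.1, x.2.1, if c = true then Sum.inr x.2.2 else Sum.inl (), Sum.inl ()) with hj
  have hjm : ∀ c, Measurable (j c) := by
    intro c
    refine measurable_fst.prodMk ((by fun_prop : Measurable fun x : 𝒲 × Bool × 𝓛 => x.2.1).prodMk
      (Measurable.prodMk ?_ measurable_const))
    cases c
    · exact measurable_const
    · exact measurable_inr.comp (by fun_prop)
  set h : Bool → Bool × Bool → ℝ := fun c x => if x = (c, false) then 1 else 0 with hh
  set K : Bool → 𝒲 × Bool × 𝓛 × ℝ → ℝ := fun c =>
    {x : 𝒲 × Bool × 𝓛 × ℝ | (x.1, x.2.1, x.2.2.1) ∈ j c ⁻¹' B}.indicator r with hK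
  have hpm : Measurable fun x : 𝒲 × Bool × 𝓛 × ℝ => (x.1, x.2.1, x.2.2.1) := by fun_prop
  have hKm : ∀ c, Measurable (K c) := fun c => hr.indicator (hpm (hjm c hB))
  have hm3 : Measurable fun z : FullData 𝒲 𝓛 => (W z, A z, L z) := by fun_prop
  have hKi : ∀ c, Integrable (fun z => K c (core z)) P := fun c =>
    hri.indicator (hm3 (hjm c hB))
  have hK0 : ∀ c, ∫ z, K c (core z) ∂P = 0 := by
    intro c
    rw [← hr0 _ (hjm c hB)]
    exact integral_indicator (f := fun z => r (core z))
      (s := {z : FullData 𝒲 𝓛 | (W z, A z, L z) ∈ j c ⁻¹' B}) (hm3 (hjm c hB))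
  have hhb : ∀ c, Integrable (fun z => h c (CL z, CY z) * K c (core z)) P := by
    intro c
    refine (hKi c).bdd_mul (c := 1) ?_ (ae_of_all _ fun z => ?_)
    · exact ((Measurable.of_discrete (f := h c)).comp
        (by fun_prop : Measurable fun z : FullData 𝒲 𝓛 => (CL z, CY z))).aestronglyMeasurable
    · simp only [hh]; split_ifs <;> simp
  rw [← integral_indicator (measurable_observe hB)]
  have e : ∀ z : FullData 𝒲 𝓛,
      (observe ⁻¹' B).indicator (fun z => (1 - ind (CY z)) * r (core z)) z =
        h true (CL z, CY z) * K true (core z) + h false (CL z, CY z) * K false (core z) := by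
    intro z
    classical
    simp only [hK, Set.indicator_apply, Set.mem_preimage, Set.mem_ofPred_eq]
    rcases z with ⟨w, a, l, y, cl, cy⟩
    cases cl <;> cases cy <;>
      simp [observe, hh, hj, ind, core, W, A, L, Y, CL, CY]
  simp_rw [e]
  rw [integral_add (hhb true) (hhb false), hP.integral_censor_mul_core (hKm true),
    hP.integral_censor_mul_core (hKm false), hK0, hK0]
  simp

/-- Bounded perturbations of the law of `W` and of the law of `Y` given `(W, A, L)` are scores. -/
lemma InModel.exists_submodel (hP : InModel P) {b : 𝒲 → ℝ} {r : 𝒲 × Bool × 𝓛 × ℝ → ℝ}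
    (hb : Measurable b) (hr : Measurable r) {C₁ C₂ : ℝ}
    (hbC : ∀ᵐ z ∂P, |b (W z)| ≤ C₁) (hrC : ∀ᵐ z ∂P, |r (core z)| ≤ C₂)
    (hb0 : ∫ z, b (W z) ∂P = 0)
    (hr0 : ∀ B : Set (𝒲 × Bool × 𝓛), MeasurableSet B →
      ∫ z in {z | (W z, A z, L z) ∈ B}, r (core z) ∂P = 0) :
    ∃ (Pt : ℝ → Measure (FullData 𝒲 𝓛)) (s : Obs 𝒲 𝓛 → ℝ), IsSubmodel P Pt s ∧
      (fun z => s (observe z)) =ᵐ[P] fun z => b (W z) + ind (CY z) * r (core z) := by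
  have hprob := hP.prob
  obtain ⟨z₀⟩ : Nonempty (FullData 𝒲 𝓛) := nonempty_of_isProbabilityMeasure P
  set C := |C₁| + |C₂| with hC
  have hC0 : 0 ≤ C := by positivity
  set q : 𝒲 × Bool × 𝓛 × ℝ → ℝ := fun x => b x.1 + r x with hq
  have hqm : Measurable q := (hb.comp measurable_fst).add hr
  -- The value L z₀ for a missing L is immaterial: the factor `obsInd` vanishes unless Y is
  -- observed, and then L is observed almost surely by monotone censoring.
  set s : Obs 𝒲 𝓛 → ℝ := fun o => b o.1 + obsInd o.2.2.2 *
    r (o.1, o.2.1, Sum.elim (fun _ => L z₀) id o.2.2.1, obsY o.2.2.2) with hs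
  have hsm : Measurable s := by
    have h1 : Measurable fun o : Obs 𝒲 𝓛 => Sum.elim (fun _ => L z₀) id o.2.2.1 :=
      (measurable_const.sumElim measurable_id).comp
        (by fun_prop : Measurable fun o : Obs 𝒲 𝓛 => o.2.2.1)
    have h2 : Measurable fun o : Obs 𝒲 𝓛 =>
        (o.1, o.2.1, Sum.elim (fun _ => L z₀) id o.2.2.1, obsY o.2.2.2) :=
      measurable_fst.prodMk ((by fun_prop : Measurable fun o : Obs 𝒲 𝓛 => o.2.1).prodMk
        (h1.prodMk (by fun_prop)))
    exact (hb.comp measurable_fst).add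
      ((by fun_prop : Measurable fun o : Obs 𝒲 𝓛 => obsInd o.2.2.2).mul (hr.comp h2))
  have hse : (fun z => s (observe z)) =ᵐ[P] fun z => b (W z) + ind (CY z) * r (core z) := by
    filter_upwards [hP.monotone_censoring] with z hz
    by_cases h : CY z = true
    · simp [hs, observe, h, hz h, obsInd, obsY, ind, core]
    · simp [hs, observe, h, obsInd, ind]
  have hqC : ∀ᵐ z ∂P, |q (core z)| ≤ C := by
    filter_upwards [hbC, hrC] with z h1 h2
    exact (abs_add_le _ _).trans
      (add_le_add (h1.trans (le_abs_self _)) (h2.trans (le_abs_self _)))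
  have hsC : ∀ᵐ z ∂P, |s (observe z)| ≤ C := by
    filter_upwards [hbC, hrC, hse] with z h1 h2 h3
    have h3' : s (observe z) = b (W z) + ind (CY z) * r (core z) := h3
    rw [h3']
    refine (abs_add_le _ _).trans (add_le_add (h1.trans (le_abs_self _)) ?_)
    rw [abs_mul]
    exact (mul_le_of_le_one_left (abs_nonneg _) (abs_ind_le _)).trans (h2.trans (le_abs_self _))
  have hbi : Integrable (fun z => b (W z)) P :=
    Integrable.of_bound (hb.comp measurable_W).aestronglyMeasurable C₁ hbC
  have hri : Integrable (fun z => r (core z)) P :=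
    Integrable.of_bound (hr.comp measurable_core).aestronglyMeasurable C₂ hrC
  have hsmall : ∀ᶠ t : ℝ in 𝓝 0, |t| * C < 1 := by
    have : Tendsto (fun t : ℝ => |t| * C) (𝓝 0) (𝓝 0) := by
      have h : Continuous fun t : ℝ => |t| * C := by fun_prop
      simpa using h.tendsto 0
    exact this.eventually (gt_mem_nhds one_pos)
  have hbound : ∀ t x : ℝ, |t| * C < 1 → |x| ≤ C → 0 ≤ 1 + t * x ∧ 1 + t * x ≤ 2 := by
    intro t x ht hx
    have h1 : |t * x| ≤ |t| * C := by
      rw [abs_mul]; exact mul_le_mul_of_nonneg_left hx (abs_nonneg _)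
    have h2 := abs_le.1 h1
    exact ⟨by linarith, by linarith⟩
  have hr_set : ∀ (B : Set Bool) (V : Set 𝒲), MeasurableSet V →
      ∫ z in A ⁻¹' B ∩ W ⁻¹' V, r (core z) ∂P = 0 := by
    intro B V hV
    rw [← hr0 {x | x.2.1 ∈ B ∧ x.1 ∈ V}]
    · rfl
    · exact ((by fun_prop : Measurable fun x : 𝒲 × Bool × 𝓛 => x.2.1)
        (MeasurableSet.of_discrete (s := B))).inter (measurable_fst hV)
  have hDi : ∀ t, Integrable (fun z => 1 + t * q (core z)) P := fun t =>
    (integrable_const 1).add ((hbi.add hri).const_mul t)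
  have hbti : ∀ t, Integrable (fun z => 1 + t * b (W z)) P := fun t =>
    (integrable_const 1).add (hbi.const_mul t)
  -- The r part integrates to zero over events in (A, W), and b involves W only, so the tilted law
  -- keeps A independent of W.
  have hD_set : ∀ (t : ℝ) (B : Set Bool) (V : Set 𝒲), MeasurableSet V →
      ∫ z in A ⁻¹' B ∩ W ⁻¹' V, (1 + t * q (core z)) ∂P =
        P.real (A ⁻¹' B) * ∫ z in W ⁻¹' V, (1 + t * b (W z)) ∂P := by
    intro t B V hV
    have hSm : MeasurableSet (A ⁻¹' B ∩ W ⁻¹' V : Set (FullData 𝒲 𝓛)) :=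
      (measurable_A MeasurableSet.of_discrete).inter (measurable_W hV)
    have e1 : ∀ z : FullData 𝒲 𝓛, 1 + t * q (core z) = (1 + t * b (W z)) + t * r (core z) := by
      intro z; simp only [hq, core]; ring
    simp_rw [e1]
    rw [integral_add (hbti t).integrableOn (hri.const_mul t).integrableOn, integral_const_mul,
      hr_set B V hV, mul_zero, add_zero, ← integral_indicator hSm,
      ← integral_indicator (measurable_W hV), ← integral_indicator_one
      (measurable_A MeasurableSet.of_discrete)]
    have h := hP.randomization.integral_fun_comp_mul_comp
      (f := B.indicator (fun _ => (1 : ℝ))) (g := V.indicator fun w => 1 + t * b w)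
      measurable_A.aemeasurable measurable_W.aemeasurable
      Measurable.of_discrete.aestronglyMeasurable
      (((hb.const_mul t).const_add 1).indicator hV).aestronglyMeasurable
    refine Eq.trans ?_ h
    congr 1; ext z
    by_cases hz1 : A z ∈ B <;> by_cases hz2 : W z ∈ V <;> simp [Set.indicator, hz1, hz2]
  have hlin : ∀ (t : ℝ), |t| * C < 1 → ∀ S : Set (FullData 𝒲 𝓛),
      ∫⁻ z in S, ENNReal.ofReal (1 + t * q (core z)) ∂P =
        ENNReal.ofReal (∫ z in S, (1 + t * q (core z)) ∂P) := by
    intro t ht S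
    refine (ofReal_integral_eq_lintegral_ofReal (hDi t).integrableOn ?_).symm
    exact ae_restrict_of_ae (hqC.mono fun z hz => (hbound t _ ht hz).1)
  -- The path is linear in t, so the observed density is exactly 1 + t s and the remainder is zero.
  refine ⟨fun t => P.withDensity fun z => ENNReal.ofReal (1 + t * q (core z)), s,
    ⟨?_, ?_, hsm, ⟨C, ?_⟩, fun t o => 1 + t * s o, ?_, ?_, ?_⟩, hse⟩
  · simp
  · filter_upwards [hsmall] with t ht
    have hDm : Measurable fun x => ENNReal.ofReal (1 + t * q x) := by fun_prop
    refine hP.withDensity (D := fun x => ENNReal.ofReal (1 + t * q x)) hDm ?_ ?_ ?_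
    · have h1 := hlin t ht Set.univ
      have h2 := hD_set t Set.univ Set.univ MeasurableSet.univ
      simp only [Set.preimage_univ, Set.inter_univ, Measure.restrict_univ, probReal_univ,
        one_mul] at h1 h2
      rw [h1, h2, integral_add (integrable_const 1) (hbi.const_mul t), integral_const_mul, hb0]
      simp
    · filter_upwards [hqC] with z hz
      rw [show (2 : ℝ≥0∞) = ENNReal.ofReal 2 by simp]
      exact ENNReal.ofReal_le_ofReal (hbound t _ ht hz).2
    · intro B V hV
      have h2 := hD_set t Set.univ V hV
      simp only [Set.preimage_univ, Set.univ_inter, probReal_univ, one_mul] at h2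
      rw [hlin t ht, hlin t ht, hD_set t B V hV, h2, ENNReal.ofReal_mul measureReal_nonneg,
        ofReal_measureReal]
  · rw [obsLaw, ae_map_iff measurable_observe.aemeasurable (measurableSet_le (by fun_prop)
      measurable_const)]
    exact hsC
  · intro t; fun_prop
  · filter_upwards [hsmall] with t ht
    ext B hB
    have hsi : Integrable (fun z => s (observe z)) P :=
      Integrable.of_bound (hsm.comp measurable_observe).aestronglyMeasurable C hsC
    have hsti : Integrable (fun z => 1 + t * s (observe z)) P :=
      (integrable_const 1).add (hsi.const_mul t)
    rw [obsLaw, Measure.map_apply measurable_observe hB, withDensity_apply _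
      (measurable_observe hB), hlin t ht, withDensity_apply _ hB, obsLaw,
      setLIntegral_map hB (by fun_prop) measurable_observe,
      ← ofReal_integral_eq_lintegral_ofReal hsti.integrableOn
        (ae_restrict_of_ae (hsC.mono fun z hz => (hbound t _ ht hz).1))]
    congr 1
    -- The full-data and observed-data densities differ by t (1 - C^Y) r, which integrates to zero
    -- over observable events.
    rw [← sub_eq_zero, ← integral_sub (hDi t).integrableOn hsti.integrableOn]
    have h := hP.setIntegral_uncensored hr hri hr0 hB
    rw [← mul_zero t, ← h, ← integral_const_mul]
    refine integral_congr_ae (ae_restrict_of_ae ?_)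
    filter_upwards [hse] with z hz
    have hz' : s (observe z) = b (W z) + ind (CY z) * r (core z) := hz
    rw [hz']
    simp only [hq, core]
    ring
  · intro ε hε
    refine Eventually.of_forall fun t => ae_of_all _ fun o => ?_
    have : 1 + t * s o - 1 - t * s o = 0 := by ring
    rw [this, abs_zero]
    positivity

end

/-! ### Attaining the bound when L adds nothing to W -/

section

variable {𝒲 𝓛 : Type*} [MeasurableSpace 𝒲] [MeasurableSpace 𝓛] {P : Measure (FullData 𝒲 𝓛)}
  {m : Bool → 𝒲 → ℝ}

/-- If `R²_{L|W} = 0`, then `L` does not improve the prediction of `Y` in either arm. -/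
lemma IsRegression.armCondYL_ae_eq (hm : IsRegression P m) (hP : InModel P) (hL : rsqLW P = 0)
    (hS : sumVar P ≠ 0) (a : Bool) :
    armCondYL P a =ᵐ[armLaw P a] fun z => m a (W z) := by
  have := hP.isProbabilityMeasure_armLaw a
  have hY : MemLp Y 2 (armLaw P a) := hP.memLp_armLaw a hP.memLp
  -- A nonzero denominator excludes R²_{L|W} = 0 through division by zero.
  have h0 : ∑ a : Bool, variance (fun z => armCondYL P a z - armCondY P a z) (armLaw P a) = 0 :=
    (div_eq_zero_iff.1 hL).resolve_right hS
  have h1 := (Finset.sum_eq_zero_iff_of_nonneg fun a _ => variance_nonneg _ _).1 h0 a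
    (Finset.mem_univ a)
  have hd : MemLp (fun z => armCondYL P a z - armCondY P a z) 2 (armLaw P a) :=
    (hY.condExp (by norm_num)).sub (hY.condExp (by norm_num))
  have hleW : sigmaW ≤ (inferInstance : MeasurableSpace (FullData 𝒲 𝓛)) :=
    measurable_iff_comap_le.1 measurable_W
  have hleLW : sigmaLW ≤ (inferInstance : MeasurableSpace (FullData 𝒲 𝓛)) :=
    measurable_iff_comap_le.1 (measurable_L.prodMk measurable_W)
  -- Zero variance makes the difference constant; both conditional expectations have mean E_a(Y), so
  -- the constant is 0.
  have h2 := ae_eq_integral_of_variance_eq_zero hd h1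
  have h3 : ∫ z, (armCondYL P a z - armCondY P a z) ∂(armLaw P a) = 0 := by
    refine (integral_sub (f := armCondYL P a) (g := armCondY P a) integrable_condExp
      integrable_condExp).trans ?_
    rw [armCondYL, armCondY, integral_condExp hleLW, integral_condExp hleW, sub_self]
  filter_upwards [h2] with z hz
  rw [h3, hm.eq a] at hz
  exact sub_eq_zero.1 hz

/-- The residual has mean zero given (W, A, L), so it is an admissible direction for perturbing the
law of Y given (W, A, L). This is what R²_{L|W} = 0 provides. -/
lemma IsRegression.setIntegral_resid (hm : IsRegression P m) (hP : InModel P) (hL : rsqLW P = 0)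
    (hS : sumVar P ≠ 0) {B : Set (𝒲 × Bool × 𝓛)} (hB : MeasurableSet B) :
    ∫ z in {z | (W z, A z, L z) ∈ B}, resid (py P) m (core z) ∂P = 0 := by
  have hprob := hP.prob
  have hBm : MeasurableSet {z : FullData 𝒲 𝓛 | (W z, A z, L z) ∈ B} :=
    (by fun_prop : Measurable fun z : FullData 𝒲 𝓛 => (W z, A z, L z)) hB
  have hleLW : sigmaLW ≤ (inferInstance : MeasurableSpace (FullData 𝒲 𝓛)) :=
    measurable_iff_comap_le.1 (measurable_L.prodMk measurable_W)
  have harm : ∀ a, ∫ z in {z | A z = a},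
      {z | (W z, A z, L z) ∈ B}.indicator (fun z => Y z - m (A z) (W z)) z ∂P = 0 := by
    intro a
    have := hP.isProbabilityMeasure_armLaw a
    have hY : MemLp Y 2 (armLaw P a) := hP.memLp_armLaw a hP.memLp
    -- Freezing the arm at a makes the event σ(L, W)-measurable.
    set S : Set (FullData 𝒲 𝓛) := {z | (W z, a, L z) ∈ B} with hS'
    have hS1 : MeasurableSet[sigmaLW] S :=
      ⟨{x | (x.2, a, x.1) ∈ B}, (by fun_prop : Measurable fun x : 𝓛 × 𝒲 => (x.2, a, x.1)) hB, rfl⟩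
    have e : ∫ z in {z | A z = a},
        {z | (W z, A z, L z) ∈ B}.indicator (fun z => Y z - m (A z) (W z)) z ∂P =
        ∫ z in {z | A z = a}, S.indicator (fun z => Y z - m a (W z)) z ∂P :=
      setIntegral_congr_fun (measurableSet_arm a) fun z hz => by
        have hz' : A z = a := hz
        have hzS : z ∈ S ↔ (W z, A z, L z) ∈ B := by rw [hz']; exact Iff.rfl
        by_cases h : (W z, A z, L z) ∈ B
        · have h1 : z ∈ {z : FullData 𝒲 𝓛 | (W z, A z, L z) ∈ B} := h
          rw [Set.indicator_of_mem h1, Set.indicator_of_mem (hzS.2 h), hz']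
        · have h1 : z ∉ {z : FullData 𝒲 𝓛 | (W z, A z, L z) ∈ B} := h
          rw [Set.indicator_of_notMem h1, Set.indicator_of_notMem (mt hzS.1 h)]
    have h2 : ∫ z, S.indicator (fun z => Y z - m a (W z)) z ∂(armLaw P a) = 0 := by
      rw [integral_indicator (hleLW _ hS1), integral_sub
        (hY.integrable (by norm_num)).integrableOn
        ((hP.memLp_armLaw a (hm.memLp hP a)).integrable (by norm_num)).integrableOn,
        ← setIntegral_condExp hleLW (hY.integrable (by norm_num)) hS1, sub_eq_zero]
      exact integral_congr_ae (ae_restrict_of_ae (hm.armCondYL_ae_eq hP hL hS a))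
    rw [hP.integral_armLaw] at h2
    rw [e]
    linarith
  have hi : Integrable (fun z => {z : FullData 𝒲 𝓛 | (W z, A z, L z) ∈ B}.indicator
      (fun z => Y z - m (A z) (W z)) z) P :=
    ((hP.memLp.sub (hm.memLp_apply hP)).integrable (by norm_num)).indicator hBm
  have e : ∀ z : FullData 𝒲 𝓛, {z : FullData 𝒲 𝓛 | (W z, A z, L z) ∈ B}.indicator
      (fun z => resid (py P) m (core z)) z = 2 / py P * (sgn (A z) *
        {z | (W z, A z, L z) ∈ B}.indicator (fun z => Y z - m (A z) (W z)) z) := by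
    intro z
    simp only [Set.indicator, resid, core]
    split_ifs
    · ring
    · simp
  rw [← integral_indicator hBm]
  simp_rw [e]
  rw [integral_const_mul, integral_sgn_mul hi, harm, harm]
  simp

lemma IsRegression.integral_effect (hm : IsRegression P m) (hP : InModel P) :
    ∫ z, (m true (W z) - m false (W z) - ate P) ∂P = 0 := by
  have := hP.prob
  have hi : Integrable (fun z => m true (W z) - m false (W z)) P :=
    ((hm.memLp hP true).sub (hm.memLp hP false)).integrable (by norm_num)
  rw [integral_sub hi (integrable_const _), hm.ate_eq hP]
  simp

/-- If `R²_{L|W} = 0`, the influence function is a limit of scores. -/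
lemma IsRegression.exists_score_approx (hm : IsRegression P m) (hP : InModel P)
    (hL : rsqLW P = 0) (hS : sumVar P ≠ 0) {ε : ℝ} (hε : 0 < ε) :
    ∃ (Pt : ℝ → Measure (FullData 𝒲 𝓛)) (s : Obs 𝒲 𝓛 → ℝ), IsSubmodel P Pt s ∧
      ∫ o, (s o - influence P m o) ^ 2 ∂(obsLaw P) ≤ (4 * ε) ^ 2 := by
  have hprob := hP.prob
  have hε' : ENNReal.ofReal ε ≠ 0 := by simpa using hε
  have hβm : Measurable fun w => m true w - m false w - ate P :=
    ((hm.meas true).sub (hm.meas false)).sub_const _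
  obtain ⟨r, C₂, hr, hrC, hr0, hre⟩ := exists_bounded_approx (P := P) measurable_core
    (π := fun x : 𝒲 × Bool × 𝓛 × ℝ => (x.1, x.2.1, x.2.2.1)) (by fun_prop)
    (measurable_resid (py P) hm.meas) (hm.memLp_resid hP) rfl
    (fun B hB => hm.setIntegral_resid hP hL hS hB) hε'
  -- Conditioning on a constant reduces the constraint to overall mean zero, which is all that the
  -- law of W demands.
  obtain ⟨b, C₁, hb, hbC, hb0, hbe⟩ := exists_bounded_approx (P := P) measurable_W
    (π := fun _ : 𝒲 => ()) measurable_const hβm (hm.memLp_effect hP) rfl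
    (fun B _ => by
      by_cases h : () ∈ B
      · simpa [h] using hm.integral_effect hP
      · simp [h]) hε'
  have hb0' : ∫ z, b (W z) ∂P = 0 := by simpa using hb0 Set.univ MeasurableSet.univ
  obtain ⟨Pt, s, hs, hse⟩ := hP.exists_submodel hb hr hbC hrC hb0' hr0
  refine ⟨Pt, s, hs, ?_⟩
  have hsub : MemLp (fun o => s o - influence P m o) 2 (obsLaw P) :=
    (hs.memLp_score hP).sub (hm.memLp_influence hP)
  refine integral_sq_le_of_eLpNorm_le hsub (by positivity) ?_
  have hsm : Measurable fun o => s o - influence P m o :=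
    hs.score_measurable.sub hm.measurable_influence
  rw [obsLaw, eLpNorm_map_measure hsm.aestronglyMeasurable measurable_observe.aemeasurable]
  have hrd : MemLp (fun z => r (core z) - resid (py P) m (core z)) 2 P :=
    (MemLp.of_bound (hr.comp measurable_core).aestronglyMeasurable C₂ hrC).sub (hm.memLp_resid hP)
  have e : ((fun o => s o - influence P m o) ∘ observe) =ᵐ[P]
      (fun z => ind (CY z) * (r (core z) - resid (py P) m (core z))) +
        fun z => b (W z) - (m true (W z) - m false (W z) - ate P) := by
    filter_upwards [hse] with z hz
    have hz' : s (observe z) = b (W z) + ind (CY z) * r (core z) := hz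
    simp only [Function.comp_apply, Pi.add_apply, hz', influence_observe]
    ring
  rw [eLpNorm_congr_ae e]
  refine (eLpNorm_add_le (memLp_ind_mul hrd).1
    ((hb.comp measurable_W).sub (hβm.comp measurable_W)).aestronglyMeasurable
    (by norm_num)).trans ?_
  have h1 : eLpNorm (fun z => ind (CY z) * (r (core z) - resid (py P) m (core z))) 2 P ≤
      ENNReal.ofReal ε + ENNReal.ofReal ε := by
    refine (eLpNorm_mono fun z => ?_).trans hre
    rw [norm_mul]
    exact mul_le_of_le_one_left (norm_nonneg _) (abs_ind_le _)
  refine (add_le_add h1 hbe).trans_eq ?_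
  rw [← ENNReal.ofReal_add hε.le hε.le, ← ENNReal.ofReal_add (by positivity) (by positivity)]
  congr 1; ring

/-- Let d = E(sφ), F = E(s²), V = E(φ²). The hypothesis reads F - 2d + V ≤ c, and d² ≥ F(2d - F) ≥
F(V - c), so d²/F ≥ V - c. If F = 0, Cauchy-Schwarz gives d = 0, hence V ≤ c. -/
lemma IsRegression.le_efficiencyBound (hm : IsRegression P m) (hP : InModel P) {c : ℝ}
    {Pt : ℝ → Measure (FullData 𝒲 𝓛)} {s : Obs 𝒲 𝓛 → ℝ} (hs : IsSubmodel P Pt s)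
    (hc : ∫ o, (s o - influence P m o) ^ 2 ∂(obsLaw P) ≤ c) :
    ENNReal.ofReal (boundValue P - c) ≤ efficiencyBound P := by
  have hsL := hs.memLp_score hP
  have hφL := hm.memLp_influence hP
  have hsφ : Integrable (fun o => s o * influence P m o) (obsLaw P) := hsL.integrable_mul hφL
  set d := ∫ o, s o * influence P m o ∂(obsLaw P) with hd
  set F := ∫ o, s o ^ 2 ∂(obsLaw P) with hF
  have hF0 : 0 ≤ F := integral_nonneg fun o => sq_nonneg _
  have e : ∫ o, (s o - influence P m o) ^ 2 ∂(obsLaw P) = F - 2 * d + boundValue P := by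
    have e1 : ∀ o, (s o - influence P m o) ^ 2 =
        s o ^ 2 - 2 * (s o * influence P m o) + influence P m o ^ 2 := fun o => by ring
    have i1 : Integrable (fun o => s o ^ 2 - 2 * (s o * influence P m o)) (obsLaw P) :=
      hsL.integrable_sq.sub (hsφ.const_mul 2)
    simp_rw [e1]
    rw [integral_add i1 hφL.integrable_sq, integral_sub hsL.integrable_sq (hsφ.const_mul 2),
      integral_const_mul, hm.integral_influence_sq hP]
  rw [e] at hc
  have hcs : d ^ 2 ≤ F * boundValue P := by
    rw [← hm.integral_influence_sq hP]
    exact sq_integral_mul_le hsL hφL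
  refine le_trans ?_ (le_sSup ⟨Pt, s, d, hs, hs.hasDerivAt_ate hP hm, rfl⟩)
  rcases hF0.eq_or_lt with h0 | hpos
  · rw [← h0] at hcs hc
    have hd0 : d = 0 := by
      have : d ^ 2 = 0 := le_antisymm (by linarith) (sq_nonneg d)
      exact pow_eq_zero_iff (two_ne_zero) |>.1 this
    rw [ENNReal.ofReal_of_nonpos (by rw [hd0] at hc; linarith)]
    exact zero_le
  · rw [ENNReal.le_div_iff_mul_le (Or.inl (by simpa using hpos)) (Or.inl (by simp)),
      ← ENNReal.ofReal_mul' hF0]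
    refine ENNReal.ofReal_le_ofReal ?_
    nlinarith [sq_nonneg (d - F)]

/-- The influence function may be unbounded, hence not itself a score; the supremum is approached by
bounded scores as ε → 0. -/
theorem efficiencyBound_eq (hP : InModel P) (hL : rsqLW P = 0) (hS : sumVar P ≠ 0) :
    efficiencyBound P = ENNReal.ofReal (boundValue P) := by
  refine le_antisymm (efficiencyBound_le hP) ?_
  obtain ⟨m, hm⟩ := exists_isRegression P
  have h : Tendsto (fun ε : ℝ => ENNReal.ofReal (boundValue P - (4 * ε) ^ 2)) (𝓝[>] 0)
      (𝓝 (ENNReal.ofReal (boundValue P))) := by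
    have hc : Continuous fun ε : ℝ => ENNReal.ofReal (boundValue P - (4 * ε) ^ 2) :=
      ENNReal.continuous_ofReal.comp (by fun_prop)
    have := hc.tendsto 0
    simp only [mul_zero, ne_eq, OfNat.ofNat_ne_zero, not_false_eq_true, zero_pow, sub_zero] at this
    exact this.mono_left nhdsWithin_le_nhds
  refine le_of_tendsto h ?_
  filter_upwards [self_mem_nhdsWithin] with ε hε
  obtain ⟨Pt, s, hs, hc⟩ := hm.exists_score_approx hP hL hS hε
  exact hm.le_efficiencyBound hP hs hc

end

/-! ### Limit theorems for i.i.d. observations -/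

section Limits

variable {Ω Ω' 𝒪 : Type*} {mΩ : MeasurableSpace Ω} {mΩ' : MeasurableSpace Ω'}
  [MeasurableSpace 𝒪] {μ : Measure Ω} {μ' : Measure Ω'} {ν : Measure 𝒪} {ξ : ℕ → Ω → 𝒪}

lemma identDistrib_of_hasLaw (hξ : ∀ k, HasLaw (ξ k) ν μ) {f : 𝒪 → ℝ} (hf : Measurable f) (k : ℕ) :
    IdentDistrib (fun ω => f (ξ k ω)) (fun ω => f (ξ 0 ω)) μ μ :=
  IdentDistrib.comp ⟨(hξ k).aemeasurable, (hξ 0).aemeasurable,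
    (hξ k).map_eq.trans (hξ 0).map_eq.symm⟩ hf

lemma integral_of_hasLaw (hξ : ∀ k, HasLaw (ξ k) ν μ) {f : 𝒪 → ℝ} (hf : Measurable f) (k : ℕ) :
    ∫ ω, f (ξ k ω) ∂μ = ∫ o, f o ∂ν := by
  rw [← (hξ k).map_eq, integral_map (hξ k).aemeasurable hf.aestronglyMeasurable]

lemma memLp_of_hasLaw (hξ : ∀ k, HasLaw (ξ k) ν μ) {f : 𝒪 → ℝ} (hf : Measurable f) {p : ℝ≥0∞}
    (hL : MemLp f p ν) (k : ℕ) : MemLp (fun ω => f (ξ k ω)) p μ := by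
  rw [← (hξ k).map_eq] at hL
  exact (memLp_map_measure_iff hf.aestronglyMeasurable (hξ k).aemeasurable).1 hL

lemma ae_tendsto_average (hξ : ∀ k, HasLaw (ξ k) ν μ) (hind : iIndepFun ξ μ) {f : 𝒪 → ℝ}
    (hf : Measurable f) (hi : Integrable f ν) :
    ∀ᵐ ω ∂μ, Tendsto (fun n : ℕ => (∑ k ∈ Finset.range n, f (ξ k ω)) / n) atTop
      (𝓝 (∫ o, f o ∂ν)) := by
  rw [← integral_of_hasLaw hξ hf 0]
  exact strong_law_ae_real (fun k ω => f (ξ k ω))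
    (memLp_one_iff_integrable.1 (memLp_of_hasLaw hξ hf (memLp_one_iff_integrable.2 hi) 0))
    (fun i j hij => (hind.indepFun hij).comp hf hf) (identDistrib_of_hasLaw hξ hf)

variable [IsProbabilityMeasure μ] [IsProbabilityMeasure μ']

/-- Convergence in distribution to zero implies convergence in probability. -/
lemma tendstoInMeasure_zero_of_tendstoInDistribution {X : ℕ → Ω → ℝ}
    (h : TendstoInDistribution X atTop (fun _ : Ω' => (0 : ℝ)) (fun _ => μ) μ') :
    TendstoInMeasure μ X atTop (fun _ => 0) := by
  rw [tendstoInMeasure_iff_measureReal_norm]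
  intro ε hε
  -- A bounded continuous test function that vanishes at 0 and equals 1 where |x| ≥ ε; Markov's
  -- inequality then applies.
  have hcont : Continuous fun x : ℝ => min (|x| / ε) 1 := by fun_prop
  have hb : ∀ x : ℝ, ‖min (|x| / ε) 1‖ ≤ 1 := fun x => by
    rw [Real.norm_of_nonneg (by positivity)]; exact min_le_right _ _
  set f : ℝ →ᵇ ℝ := BoundedContinuousFunction.ofNormedAddCommGroup _ hcont 1 hb with hf
  have ht := (ProbabilityMeasure.tendsto_iff_forall_integral_tendsto.1 h.tendsto) f
  have e1 : ∀ n, ∫ x, f x ∂(μ.map (X n)) = ∫ ω, f (X n ω) ∂μ := fun n =>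
    integral_map (h.forall_aemeasurable n) f.continuous.aestronglyMeasurable
  have e2 : ∫ x, f x ∂(μ'.map fun _ : Ω' => (0 : ℝ)) = 0 := by
    rw [integral_map (by fun_prop) f.continuous.aestronglyMeasurable]
    simp [hf]
  simp only [ProbabilityMeasure.coe_mk, e1, e2] at ht
  refine squeeze_zero (fun n => measureReal_nonneg) (fun n => ?_) ht
  have hi : Integrable (fun ω => f (X n ω)) μ :=
    Integrable.of_bound (f.continuous.measurable.comp_aemeasurable
      (h.forall_aemeasurable n)).aestronglyMeasurable 1 (ae_of_all _ fun ω => hb _)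
  have hm := mul_meas_ge_le_integral_of_nonneg (ae_of_all μ fun ω =>
    (le_min (by positivity) zero_le_one : (0 : ℝ) ≤ min (|X n ω| / ε) 1)) hi 1
  rw [one_mul] at hm
  refine le_trans (measureReal_mono ?_) hm
  intro ω hω
  have hω' : ε ≤ ‖X n ω - 0‖ := hω
  rw [sub_zero, Real.norm_eq_abs] at hω'
  exact le_min ((one_le_div hε).2 hω') le_rfl

/-- Slutsky's theorem for the product, whose limit is the constant 0. -/
lemma TendstoInDistribution.mul_tendstoInMeasure_zero {X δ : ℕ → Ω → ℝ} {Z : Ω' → ℝ}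
    (hX : TendstoInDistribution X atTop Z (fun _ => μ) μ')
    (hδ : TendstoInMeasure μ δ atTop fun _ => 0) (hm : ∀ n, AEMeasurable (δ n) μ) :
    TendstoInMeasure μ (fun n ω => X n ω * δ n ω) atTop fun _ => 0 := by
  have h := hX.continuous_comp_prodMk_of_tendstoInMeasure_const
    (g := fun x : ℝ × ℝ => x.1 * x.2) (by fun_prop) hδ hm
  simp only [mul_zero] at h
  exact tendstoInMeasure_zero_of_tendstoInDistribution h

/-- The central limit theorem for a centered function of i.i.d. observations. -/
lemma tendstoInDistribution_sum (hξ : ∀ k, HasLaw (ξ k) ν μ) (hind : iIndepFun ξ μ) {f : 𝒪 → ℝ}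
    (hf : Measurable f) (hL : MemLp f 2 ν) (h0 : ∫ o, f o ∂ν = 0) :
    TendstoInDistribution (fun (n : ℕ) ω => (√(n : ℝ))⁻¹ * ∑ k ∈ Finset.range n, f (ξ k ω)) atTop
      (id : ℝ → ℝ) (fun _ => μ) (gaussianReal 0 (∫ o, f o ^ 2 ∂ν).toNNReal) := by
  have hv : variance (fun ω => f (ξ 0 ω)) μ = ∫ o, f o ^ 2 ∂ν := by
    rw [variance_of_integral_eq_zero (memLp_of_hasLaw hξ hf hL 0).1.aemeasurable
      (by rw [integral_of_hasLaw hξ hf, h0])]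
    exact integral_of_hasLaw hξ (f := fun o => f o ^ 2) (hf.pow_const 2) 0
  have h := tendstoInDistribution_inv_sqrt_mul_sum_sub (P := μ)
    (P' := gaussianReal 0 (∫ o, f o ^ 2 ∂ν).toNNReal) (Y := id)
    (X := fun k ω => f (ξ k ω)) (by rw [hv]; exact HasLaw.id)
    (memLp_of_hasLaw hξ hf hL 0) (hind.comp (fun _ => f) fun _ => hf)
    (identDistrib_of_hasLaw hξ hf)
  have h1 : ∫ ω, f (ξ 0 ω) ∂μ = 0 := by rw [integral_of_hasLaw hξ hf, h0]
  simpa only [h1, mul_zero, sub_zero] using h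

end Limits

/-! ### Asymptotic normality of the unadjusted estimator -/

section Unadjusted

variable {𝒲 𝓛 : Type*} [MeasurableSpace 𝒲] [MeasurableSpace 𝓛] {P : Measure (FullData 𝒲 𝓛)}

/-- The observed outcome in arm `a`, and `0` otherwise. -/
def armNum (a : Bool) (o : Obs 𝒲 𝓛) : ℝ := if o.2.1 = a then obsY o.2.2.2 else 0

/-- The indicator of an observed outcome in arm `a`. -/
def armDen (a : Bool) (o : Obs 𝒲 𝓛) : ℝ := if o.2.1 = a then obsInd o.2.2.2 else 0

@[fun_prop] lemma measurable_armNum (a : Bool) : Measurable (armNum a : Obs 𝒲 𝓛 → ℝ) :=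
  Measurable.ite ((by fun_prop : Measurable fun o : Obs 𝒲 𝓛 => o.2.1) (measurableSet_singleton a))
    (by fun_prop) measurable_const

@[fun_prop] lemma measurable_armDen (a : Bool) : Measurable (armDen a : Obs 𝒲 𝓛 → ℝ) :=
  Measurable.ite ((by fun_prop : Measurable fun o : Obs 𝒲 𝓛 => o.2.1) (measurableSet_singleton a))
    (by fun_prop) measurable_const

lemma armMean_eq {𝒲 𝓛 : Type*} (a : Bool) {n : ℕ} (o : Fin n → Obs 𝒲 𝓛) :
    armMean a o = (∑ i, armNum a (o i)) / ∑ i, armDen a (o i) := rfl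

lemma measurable_unadjusted (n : ℕ) : Measurable (unadjusted n : (Fin n → Obs 𝒲 𝓛) → ℝ) := by
  have h : ∀ a, Measurable (armMean a : (Fin n → Obs 𝒲 𝓛) → ℝ) := fun a =>
    (Finset.measurable_sum _ fun i _ => (measurable_armNum a).comp (measurable_pi_apply i)).div
      (Finset.measurable_sum _ fun i _ => (measurable_armDen a).comp (measurable_pi_apply i))
  exact (h true).sub (h false)

/-- The mean outcome in arm `a`. -/
def mu (P : Measure (FullData 𝒲 𝓛)) (a : Bool) : ℝ := ∫ z, Y z ∂(armLaw P a)

/-- The centered outcome in arm `a` among participants with observed outcome. -/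
def armCentered (P : Measure (FullData 𝒲 𝓛)) (a : Bool) (o : Obs 𝒲 𝓛) : ℝ :=
  armNum a o - mu P a * armDen a o

@[fun_prop] lemma measurable_armCentered (a : Bool) :
    Measurable (armCentered P a : Obs 𝒲 𝓛 → ℝ) :=
  (measurable_armNum a).sub ((measurable_armDen a).const_mul _)

lemma armDen_observe {𝒲 𝓛 : Type*} (a : Bool) (z : FullData 𝒲 𝓛) :
    armDen a (observe z) = ind (CY z) * if A z = a then 1 else 0 := by
  simp only [armDen, obsInd_observe, mul_ite, mul_one, mul_zero]
  rfl

lemma armCentered_observe (a : Bool) (z : FullData 𝒲 𝓛) :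
    armCentered P a (observe z) = ind (CY z) * if A z = a then Y z - mu P a else 0 := by
  rw [armCentered, armDen_observe]
  simp only [armNum, obsY_observe]
  have : (observe z).2.1 = A z := rfl
  rw [this]
  split_ifs <;> ring

lemma integral_ite_arm (a : Bool) (f : FullData 𝒲 𝓛 → ℝ) :
    ∫ z, (if A z = a then f z else 0) ∂P = ∫ z in {z | A z = a}, f z ∂P := by
  rw [← integral_indicator (measurableSet_arm a)]
  congr 1; ext z
  by_cases h : A z = a <;> simp [Set.indicator, h]

lemma measurable_ite_arm (a : Bool) {f : 𝒲 × Bool × 𝓛 × ℝ → ℝ} (hf : Measurable f) :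
    Measurable fun x => if x.2.1 = a then f x else 0 :=
  Measurable.ite ((by fun_prop : Measurable fun x : 𝒲 × Bool × 𝓛 × ℝ => x.2.1)
    (measurableSet_singleton a)) hf measurable_const

lemma InModel.integral_armDen (hP : InModel P) (a : Bool) :
    ∫ o, armDen a o ∂(obsLaw P) = py P / 2 := by
  have := hP.prob
  rw [integral_obsLaw (measurable_armDen a)]
  simp_rw [armDen_observe]
  have h := hP.integral_CY_mul_core (measurable_ite_arm a (f := fun _ => 1) measurable_const)
  refine h.trans ?_
  have h2 := integral_ite_arm (P := P) a fun _ => 1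
  have h3 : P.real {z | A z = a} = 1 / 2 := by simp [measureReal_def, hP.arm_half]
  have h4 : ∫ z, (if A z = a then (1 : ℝ) else 0) ∂P = 1 / 2 := by
    rw [h2, setIntegral_const, h3]; simp
  exact (congrArg (py P * ·) h4).trans (by ring)

lemma InModel.integral_armCentered (hP : InModel P) (a : Bool) :
    ∫ o, armCentered P a o ∂(obsLaw P) = 0 := by
  have := hP.prob
  have := hP.isProbabilityMeasure_armLaw a
  rw [integral_obsLaw (measurable_armCentered a)]
  simp_rw [armCentered_observe]
  have h := hP.integral_CY_mul_core
    (measurable_ite_arm a (f := fun x => x.2.2.2 - mu P a) (by fun_prop))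
  refine h.trans ?_
  have h2 := integral_ite_arm (P := P) a fun z => Y z - mu P a
  have h3 := hP.integral_armLaw a fun z => Y z - mu P a
  rw [integral_sub ((hP.memLp_armLaw a hP.memLp).integrable (by norm_num)) (integrable_const _)] at h3
  simp only [integral_const, probReal_univ, one_smul] at h3
  have h4 : ∫ z, (if A z = a then Y z - mu P a else 0) ∂P = 0 := by
    rw [h2]
    have : (∫ z, Y z ∂(armLaw P a)) = mu P a := rfl
    linarith
  exact (congrArg (py P * ·) h4).trans (mul_zero _)

lemma InModel.memLp_armCentered (hP : InModel P) (a : Bool) :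
    MemLp (armCentered P a) 2 (obsLaw P) := by
  have := hP.prob
  rw [memLp_obsLaw_iff (measurable_armCentered a)]
  refine (hP.memLp.sub (memLp_const (mu P a))).mono
    ((measurable_armCentered a).comp measurable_observe).aestronglyMeasurable
    (ae_of_all _ fun z => ?_)
  rw [armCentered_observe, norm_mul]
  refine (mul_le_of_le_one_left (norm_nonneg _) (abs_ind_le _)).trans ?_
  split_ifs
  · exact le_rfl
  · simp

lemma InModel.integrable_armDen (hP : InModel P) (a : Bool) :
    Integrable (armDen a) (obsLaw P) := by
  have := hP.prob
  rw [integrable_obsLaw_iff (measurable_armDen a)]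
  refine Integrable.of_bound ((measurable_armDen a).comp measurable_observe).aestronglyMeasurable 1
    (ae_of_all _ fun z => ?_)
  rw [armDen_observe, norm_mul]
  refine (mul_le_of_le_one_left (norm_nonneg _) (abs_ind_le _)).trans ?_
  split_ifs <;> simp

lemma InModel.setIntegral_centered_sq (hP : InModel P) (a : Bool) :
    ∫ z in {z | A z = a}, (Y z - mu P a) ^ 2 ∂P = variance Y (armLaw P a) / 2 := by
  rw [variance_eq_integral measurable_Y.aemeasurable, hP.integral_armLaw]
  simp only [mu]
  ring

/-- The influence function of the unadjusted estimator. -/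
def unadjustedInfluence (P : Measure (FullData 𝒲 𝓛)) (o : Obs 𝒲 𝓛) : ℝ :=
  2 / py P * (armCentered P true o - armCentered P false o)

lemma measurable_unadjustedInfluence : Measurable (unadjustedInfluence P : Obs 𝒲 𝓛 → ℝ) :=
  ((measurable_armCentered true).sub (measurable_armCentered false)).const_mul _

/-- The arms are disjoint, so there is no cross term; the constant is (4/p²) · p · (1/2). -/
lemma InModel.integral_unadjustedInfluence_sq (hP : InModel P) :
    ∫ o, unadjustedInfluence P o ^ 2 ∂(obsLaw P) = 2 / py P * sumVar P := by
  have := hP.prob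
  have hp := hP.py_pos'.ne'
  rw [integral_obsLaw (φ := fun o => unadjustedInfluence P o ^ 2)
    (measurable_unadjustedInfluence.pow_const 2)]
  have e : ∀ z : FullData 𝒲 𝓛, unadjustedInfluence P (observe z) ^ 2 =
      4 / py P ^ 2 * (ind (CY z) * ((if A z = true then (Y z - mu P true) ^ 2 else 0) +
        if A z = false then (Y z - mu P false) ^ 2 else 0)) := by
    intro z
    rw [unadjustedInfluence, armCentered_observe, armCentered_observe]
    cases CY z <;> cases A z <;> simp [ind] <;> ring
  have hi : ∀ a, Integrable (fun z => if A z = a then (Y z - mu P a) ^ 2 else 0) P := by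
    intro a
    refine (hP.memLp.sub (memLp_const (mu P a))).integrable_sq.mono
      ((measurable_ite_arm a (f := fun x => (x.2.2.2 - mu P a) ^ 2) (by fun_prop)).comp
        measurable_core).aestronglyMeasurable (ae_of_all _ fun z => ?_)
    split_ifs
    · exact le_rfl
    · rw [norm_zero]; exact norm_nonneg _
  simp_rw [e]
  rw [integral_const_mul, show ∫ z, ind (CY z) * ((if A z = true then (Y z - mu P true) ^ 2 else 0) +
        if A z = false then (Y z - mu P false) ^ 2 else 0) ∂P =
      py P * ∫ z, ((if A z = true then (Y z - mu P true) ^ 2 else 0) +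
        if A z = false then (Y z - mu P false) ^ 2 else 0) ∂P from
      hP.integral_CY_mul_core
        ((measurable_ite_arm true (f := fun x => (x.2.2.2 - mu P true) ^ 2) (by fun_prop)).add
        (measurable_ite_arm false (f := fun x => (x.2.2.2 - mu P false) ^ 2) (by fun_prop))),
    integral_add (hi true) (hi false), integral_ite_arm, integral_ite_arm,
    hP.setIntegral_centered_sq, hP.setIntegral_centered_sq, sumVar, Fintype.sum_bool]
  field_simp
  ring

lemma tendsto_inv_sub_inv {D : ℕ → ℝ} {q : ℝ} (hq : q ≠ 0)
    (h : Tendsto (fun n => D n / (n : ℝ)) atTop (𝓝 q)) :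
    Tendsto (fun n : ℕ => (n : ℝ) / D n - q⁻¹) atTop (𝓝 0) := by
  have := (h.inv₀ hq).sub_const q⁻¹
  simpa only [inv_div, sub_self] using this

/-- The unadjusted estimator is asymptotically normal. -/
theorem isAVar_unadjusted (hP : InModel P) :
    IsAVar P unadjusted (2 / py P * sumVar P).toNNReal := by
  refine ⟨measurable_unadjusted, fun f => ?_⟩
  have hprob := hP.prob
  have hobs := hP.isProbabilityMeasure_obsLaw
  have hp := hP.py_pos'
  -- All sample sizes are realized on one space, as the almost sure law of large numbers requires.
  obtain ⟨Ω, mΩ, μ, ξ, hξm, hξ, hind, hμ⟩ := exists_iid ℕ (obsLaw P)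
  have hsample : ∀ n, sampleLaw P n = μ.map fun ω (i : Fin n) => ξ i ω := by
    intro n
    rw [(iIndepFun_iff_map_fun_eq_pi_map fun i : Fin n => (hξm i).aemeasurable).1
      (hind.precomp Fin.val_injective), sampleLaw]
    congr 1; ext1 i
    exact (hξ i).map_eq.symm
  have htuple : ∀ n, Measurable fun ω (i : Fin n) => ξ i ω := fun n =>
    measurable_pi_lambda _ fun i => hξm i
  set c : ℕ → Ω → ℝ := fun n ω => √(n : ℝ) * (unadjusted n (fun i : Fin n => ξ i ω) - ate P) with hc
  have hcm : ∀ n, Measurable (c n) := fun n =>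
    (((measurable_unadjusted n).comp (htuple n)).sub_const _).const_mul _
  set S : (Obs 𝒲 𝓛 → ℝ) → ℕ → Ω → ℝ := fun g n ω => ∑ k ∈ Finset.range n, g (ξ k ω) with hS
  have hSm : ∀ {g : Obs 𝒲 𝓛 → ℝ}, Measurable g → ∀ n, Measurable (S g n) := fun hg n =>
    Finset.measurable_sum _ fun k _ => hg.comp (hξm k)
  -- The error in replacing the random normalization of an arm mean by its limit 2/p. Then √n (arm
  -- mean - μ_a) = (2/p) U + U δ, where U is the normalized centered sum and U δ is negligible.
  set δ : Bool → ℕ → Ω → ℝ := fun a n ω => (n : ℝ) / S (armDen a) n ω - 2 / py P with hδ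
  have hδm : ∀ a n, Measurable (δ a n) := fun a n =>
    ((hSm (measurable_armDen a) n).const_div _).sub_const _
  have hlln : ∀ a, ∀ᵐ ω ∂μ, Tendsto (fun n : ℕ => S (armDen a) n ω / n) atTop (𝓝 (py P / 2)) := by
    intro a
    have := ae_tendsto_average hξ hind (measurable_armDen a) (hP.integrable_armDen a)
    rwa [hP.integral_armDen] at this
  have hδ0 : ∀ a, TendstoInMeasure μ (δ a) atTop fun _ => 0 := by
    intro a
    refine tendstoInMeasure_of_tendsto_ae (fun n => (hδm a n).aestronglyMeasurable) ?_
    filter_upwards [hlln a] with ω hω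
    simpa only [inv_div] using tendsto_inv_sub_inv (by positivity) hω
  set U : Bool → ℕ → Ω → ℝ := fun a n ω => (√(n : ℝ))⁻¹ * S (armCentered P a) n ω with hU
  have hUm : ∀ a n, Measurable (U a n) := fun a n => (hSm (measurable_armCentered a) n).const_mul _
  have hUlim : ∀ a, TendstoInMeasure μ (fun n ω => U a n ω * δ a n ω) atTop fun _ => 0 := fun a =>
    TendstoInDistribution.mul_tendstoInMeasure_zero
      (tendstoInDistribution_sum hξ hind (measurable_armCentered a) (hP.memLp_armCentered a)
        (hP.integral_armCentered a)) (hδ0 a) fun n => (hδm a n).aemeasurable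
  have hUneg : TendstoInMeasure μ (fun n ω => -(U false n ω * δ false n ω)) atTop fun _ => 0 := by
    have := hUlim false
    rw [tendstoInMeasure_iff_norm] at this ⊢
    simpa using this
  have hF := tendstoInDistribution_sum hξ hind (measurable_unadjustedInfluence (P := P))
    (((hP.memLp_armCentered true).sub (hP.memLp_armCentered false)).const_mul (2 / py P)) (by
      simp only [unadjustedInfluence]
      rw [integral_const_mul, integral_sub ((hP.memLp_armCentered true).integrable (by norm_num))
        ((hP.memLp_armCentered false).integrable (by norm_num)), hP.integral_armCentered,
        hP.integral_armCentered]
      simp)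
  have hF2 := (hF.add_of_tendstoInMeasure_const (hUlim true) fun n =>
    ((hUm true n).mul (hδm true n)).aemeasurable).add_of_tendstoInMeasure_const hUneg fun n =>
    ((hUm false n).mul (hδm false n)).neg.aemeasurable
  simp only [add_zero] at hF2
  have hlim := tendstoInDistribution_of_tendstoInMeasure_sub c _ hF2 (by
    refine tendstoInMeasure_of_tendsto_ae (fun n => ?_) ?_
    · exact ((hcm n).sub ((((hSm measurable_unadjustedInfluence n).const_mul _).add
        ((hUm true n).mul (hδm true n))).add
        ((hUm false n).mul (hδm false n)).neg)).aestronglyMeasurable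
    · filter_upwards [hlln true, hlln false] with ω h1 h0
      refine tendsto_const_nhds.congr' ?_
      have hpos : (0 : ℝ) < py P / 2 := by positivity
      -- The linearization is an exact identity once both arms contain an observed outcome, which
      -- almost surely holds for all large n.
      filter_upwards [h1.eventually (lt_mem_nhds hpos), h0.eventually (lt_mem_nhds hpos),
        eventually_gt_atTop 0] with n hn1 hn0 hn
      have hn' : (0 : ℝ) < n := by exact_mod_cast hn
      have hd1 : S (armDen true) n ω ≠ 0 := fun h => by rw [h] at hn1; simp at hn1
      have hd0 : S (armDen false) n ω ≠ 0 := fun h => by rw [h] at hn0; simp at hn0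
      have hsq : √(n : ℝ) ≠ 0 := (Real.sqrt_pos.2 hn').ne'
      have hcen : ∀ a, S (armCentered P a) n ω =
          S (armNum a) n ω - mu P a * S (armDen a) n ω := by
        intro a
        simp only [hS, armCentered, Finset.sum_sub_distrib, Finset.mul_sum]
      have hFS : S (unadjustedInfluence P) n ω =
          2 / py P * (S (armCentered P true) n ω - S (armCentered P false) n ω) := by
        simp only [hS, unadjustedInfluence, ← Finset.mul_sum, Finset.sum_sub_distrib]
      have hce : c n ω = √(n : ℝ) * (S (armNum true) n ω / S (armDen true) n ω -
          S (armNum false) n ω / S (armDen false) n ω - (mu P true - mu P false)) := by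
        simp only [hc, unadjusted, armMean_eq, hS, Finset.sum_range]
        rfl
      have key : ∀ a, S (armDen a) n ω ≠ 0 → √(n : ℝ) * (S (armNum a) n ω / S (armDen a) n ω - mu P a) =
          U a n ω * (2 / py P) + U a n ω * δ a n ω := by
        intro a ha
        simp only [hU, hδ]
        rw [hcen]
        have : (√(n : ℝ))⁻¹ * n = √(n : ℝ) := by
          rw [inv_mul_eq_div, Real.div_sqrt]
        calc _ = ((√(n : ℝ))⁻¹ * n) * (S (armNum a) n ω / S (armDen a) n ω - mu P a) := by rw [this]
          _ = _ := by field_simp; ring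
      have k1 := key true hd1
      have k0 := key false hd0
      show (0 : ℝ) = c n ω - ((√(n : ℝ))⁻¹ * S (unadjustedInfluence P) n ω +
        U true n ω * δ true n ω + -(U false n ω * δ false n ω))
      rw [hce, hFS]
      simp only [hU] at k1 k0 ⊢
      linear_combination k0 - k1) fun n => (hcm n).aemeasurable
  have ht := (ProbabilityMeasure.tendsto_iff_forall_integral_tendsto.1 hlim.tendsto) f
  simp only [ProbabilityMeasure.coe_mk] at ht
  rw [hP.integral_unadjustedInfluence_sq] at ht
  refine (ht.congr fun n => ?_).trans_eq ?_
  · rw [integral_map (hcm n).aemeasurable f.continuous.aestronglyMeasurable, hsample,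
      integral_map (htuple n).aemeasurable]
    exact (f.continuous.measurable.comp
      (((measurable_unadjusted n).sub_const _).const_mul _)).aestronglyMeasurable
  · simp

end Unadjusted

/-! ### Variance identities and the efficiency ratio -/

section

variable {𝒲 𝓛 : Type*} [MeasurableSpace 𝒲] [MeasurableSpace 𝓛] {P : Measure (FullData 𝒲 𝓛)}
  {m : Bool → 𝒲 → ℝ}

/-- `E(Y | W)` is the average of the two regression functions. -/
lemma IsRegression.condY_ae_eq (hm : IsRegression P m) (hP : InModel P) :
    condY P =ᵐ[P] fun z => (1 / 2) * (m true (W z) + m false (W z)) := by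
  have := hP.prob
  have hle : sigmaW ≤ (inferInstance : MeasurableSpace (FullData 𝒲 𝓛)) :=
    measurable_iff_comap_le.1 measurable_W
  have hmi : ∀ a, Integrable (fun z => m a (W z)) P := fun a =>
    (hm.memLp hP a).integrable (by norm_num)
  refine (ae_eq_condExp_of_forall_setIntegral_eq hle hP.integrable_Y
    (fun s _ _ => (((hmi true).add (hmi false)).const_mul _).integrableOn) ?_ ?_).symm
  · rintro s ⟨V, hV, rfl⟩ -
    have hf : Measurable (V.indicator fun _ : 𝒲 => (1 : ℝ)) := measurable_const.indicator hV
    have hfL : MemLp (fun z : FullData 𝒲 𝓛 => V.indicator (fun _ => (1 : ℝ)) (W z)) 2 P :=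
      MemLp.of_bound (hf.comp measurable_W).aestronglyMeasurable 1 (ae_of_all _ fun z => by
        by_cases h : W z ∈ V <;> simp [h])
    have hind : ∀ g : FullData 𝒲 𝓛 → ℝ, ∫ z in W ⁻¹' V, g z ∂P =
        ∫ z, V.indicator (fun _ => (1 : ℝ)) (W z) * g z ∂P := by
      intro g
      rw [← integral_indicator (measurable_W hV)]
      congr 1; ext z
      by_cases h : W z ∈ V
      · rw [Set.indicator_of_mem h, Set.indicator_of_mem (show z ∈ W ⁻¹' V from h), one_mul]
      · rw [Set.indicator_of_notMem h, Set.indicator_of_notMem (show z ∉ W ⁻¹' V from h), zero_mul]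
    have hi : ∀ a, Integrable (fun z => V.indicator (fun _ => (1 : ℝ)) (W z) * m a (W z)) P :=
      fun a => hfL.integrable_mul (hm.memLp hP a)
    have hY : Integrable (fun z => V.indicator (fun _ => (1 : ℝ)) (W z) * Y z) P :=
      hfL.integrable_mul hP.memLp
    rw [hind, hind, integral_eq_add_arms hY, hm.setIntegral_mul hP true hf hfL,
      hm.setIntegral_mul hP false hf hfL, ← add_div, ← integral_add (hi true) (hi false),
      ← integral_div]
    congr 1; ext z
    simp only [Pi.add_apply]
    ring
  · exact ((((hm.meas true).add (hm.meas false)).const_mul (1 / 2)).comp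
      (comap_measurable W)).aestronglyMeasurable

/-- The parallelogram identity for the variances of the regression functions. -/
lemma InModel.varEffect_add (hP : InModel P) :
    varEffect P + 4 * variance (condY P) P = 2 * ∑ a : Bool, variance (armCondY P a) P := by
  have := hP.prob
  obtain ⟨m, hm⟩ := exists_isRegression P
  have h1 := hm.memLp hP true
  have h0 := hm.memLp hP false
  have e1 : variance (condY P) P = (1 / 2) ^ 2 *
      variance ((fun z => m true (W z)) + fun z => m false (W z)) P := by
    rw [variance_congr (hm.condY_ae_eq hP), ← variance_const_mul]
    rfl
  have e2 : varEffect P = variance ((fun z => m true (W z)) - fun z => m false (W z)) P := by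
    rw [varEffect, hm.eq, hm.eq]
    rfl
  rw [e1, e2, variance_add h1 h0, variance_sub h1 h0, Fintype.sum_bool, hm.eq, hm.eq]
  simp only [Function.comp_def]
  ring

/-- The residual second moment in each arm is nonnegative. -/
lemma InModel.sum_variance_armCondY_le (hP : InModel P) :
    ∑ a : Bool, variance (armCondY P a) P ≤ sumVar P := by
  obtain ⟨m, hm⟩ := exists_isRegression P
  refine Finset.sum_le_sum fun a _ => ?_
  have h := hm.setIntegral_resid_sq hP a
  have h2 : 0 ≤ ∫ z in {z | A z = a}, (Y z - m a (W z)) ^ 2 ∂P :=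
    integral_nonneg fun z => sq_nonneg _
  linarith

/-- Makes the ratios γ, R²_W and R²_{L|W} genuine quotients; the hypotheses of both cases supply the
positivity assumed here. -/
lemma InModel.sumVar_pos (hP : InModel P) (h : 0 < varEffect P + 4 * variance (condY P) P) :
    0 < sumVar P := by
  rw [hP.varEffect_add] at h
  linarith [hP.sum_variance_armCondY_le]

/-- The factor 2S/p is the unadjusted variance, positive and finite, so it cancels in [0, ∞]; x = 0
gives the value ∞. -/
lemma InModel.isARE_of_boundValue_eq (hP : InModel P) (hL : rsqLW P = 0) (hS : 0 < sumVar P) {x : ℝ}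
    (hx : boundValue P = 2 / py P * sumVar P * x) {T : Estimator 𝒲 𝓛} (hT : IsEfficientRAL P T) :
    IsARE P T unadjusted (1 / ENNReal.ofReal x) := by
  obtain ⟨v, ⟨hv, -, -⟩, hve⟩ := hT
  have hp := hP.py_pos'
  have hK : 0 < 2 / py P * sumVar P := by positivity
  refine ⟨v, _, hv, isAVar_unadjusted hP, ?_⟩
  rw [hve, efficiencyBound_eq hP hL hS.ne', hx, ENNReal.ofReal_mul hK.le]
  change _ = ENNReal.ofReal (2 / py P * sumVar P) / _
  conv_rhs => rw [← mul_one (ENNReal.ofReal (2 / py P * sumVar P)), mul_assoc, one_mul]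
  rw [ENNReal.mul_div_mul_left _ _ (by simpa using hK) ENNReal.ofReal_ne_top]

end

end Trial

end

theorem mainTheorem5 {𝒲 𝓛 : Type*} [MeasurableSpace 𝒲] [MeasurableSpace 𝓛]
    (P : Measure (Trial.FullData 𝒲 𝓛)) (hP : Trial.InModel P) (hL : Trial.rsqLW P = 0) :
    (0 < Trial.varEffect P → variance (Trial.condY P) P = 0 →
      Trial.gammaHet P = 2 * Trial.rsqW P ∧
      ∀ T : Trial.Estimator 𝒲 𝓛, Trial.IsEfficientRAL P T →
        Trial.IsARE P T Trial.unadjusted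
          (1 / ENNReal.ofReal (1 - (1 - Trial.py P) * Trial.rsqW P))) ∧
    (Trial.varEffect P = 0 → 0 < variance (Trial.condY P) P →
      Trial.gammaHet P = 0 ∧
      ∀ T : Trial.Estimator 𝒲 𝓛, Trial.IsEfficientRAL P T →
        Trial.IsARE P T Trial.unadjusted
          (1 / ENNReal.ofReal (1 - Trial.rsqW P))) := by
  have hpar := hP.varEffect_add
  have hp := hP.py_pos'.ne'
  refine ⟨fun hE hC => ?_, fun hE hC => ?_⟩
  · have hS : 0 < Trial.sumVar P := hP.sumVar_pos (by rw [hC]; linarith)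
    have hS' := hS.ne'
    rw [hC, mul_zero, add_zero] at hpar
    refine ⟨by rw [Trial.gammaHet, Trial.rsqW, hpar]; ring, fun T hT => ?_⟩
    refine hP.isARE_of_boundValue_eq hL hS ?_ hT
    -- Here the bound is (2S/p)(1 - R²_W) + 2S R²_W = (2S/p)(1 - (1 - p) R²_W).
    rw [Trial.boundValue, hpar, Trial.rsqW]
    field_simp
    ring
  · have hS : 0 < Trial.sumVar P := hP.sumVar_pos (by rw [hE]; linarith)
    have hS' := hS.ne'
    refine ⟨by rw [Trial.gammaHet, hE, zero_div], fun T hT => ?_⟩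
    refine hP.isARE_of_boundValue_eq hL hS ?_ hT
    -- Without an effect term, p enters only through the common factor 2S/p.
    rw [Trial.boundValue, hE, Trial.rsqW]
    field_simp
    ring
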